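/- Let $\mathcal{L}^{\mathrm{II}}$ be monadic second-order logic with full semantics: it extends first-order logic by second-order variables $X, Y, \dots$ ranging over all subsets of the underlying set of a structure, with atomic formulas $x \mathrel{\varepsilon} X$ and quantification over second-order variables. For a cardinal $\kappa$, an $\mathcal{L}^{\mathrm{II}}$-theory (a set of $\mathcal{L}^{\mathrm{II}}$-sentences) $T$ is $<\kappa$-satisfiable if every $T_0 \subseteq T$ with $|T_0| < \kappa$ has a model. Let $\mathrm{WCS}(\mathcal{L}^{\mathrm{II}})$ be the class of all cardinals $\kappa > \aleph_0$ such that every $<\kappa$-satisfiable $\mathcal{L}^{\mathrm{II}}$-theory in a signature with at most $\kappa$ non-logical symbols has a model, and let $\mathrm{wcn}(\mathcal{L}^{\mathrm{II}}) = \min(\mathrm{WCS}(\mathcal{L}^{\mathrm{II}}) \cup \{\infty\})$. A cardinal is weakly inaccessible if it is an uncountable regular limit cardinal, and weakly Mahlo if it is weakly inaccessible and the set of weakly inaccessible cardinals below it is stationary in it. For a property $P$ of cardinals and an ordinal $\alpha$, say by recursion on $\alpha$ that $\kappa$ is an $\alpha$-fold stationary limit of $P$-cardinals if $\kappa$ has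 property $P$ and, for every $\beta < \alpha$, the set of cardinals $\nu < \kappa$ that are $\beta$-fold stationary limits of $P$-cardinals is stationary in $\kappa$. Let $P_0$ be the property of being weakly Mahlo, and let $P_{i+1}(\kappa)$ say that $\kappa$ is a $\kappa$-fold stationary limit of $P_i$-cardinals. (1) If $\mathrm{wcn}(\mathcal{L}^{\mathrm{II}}) < \infty$, then for all $i, k \in \mathbb{N}$ there is a least cardinal that is a $k$-fold stationary limit of $P_i$-cardinals, and $\mathrm{wcn}(\mathcal{L}^{\mathrm{II}})$ is greater than it. In particular $\mathrm{wcn}(\mathcal{L}^{\mathrm{II}})$ is greater than the first weakly Mahlo cardinal ($i = k = 0$), the first weakly hyper-Mahlo cardinal, the first weakly hyper-hyper-Mahlo cardinal, and so on, whether weakly hyper-Mahlo means weakly Mahlo with stationarily many weakly Mahlo cardinals below ($i = 0$; iterated: $k = 1, 2, 3, \dots$) or $\kappa$ being weakly $\kappa$-Mahlo ($k = 0$; iterated: $i = 1, 2, 3, \dots$). (2) For every $n \in \mathbb{N}$, the $n$-th cardinal successor $(2^{\aleph_0})^{+n}$ of $2^{\aleph_0}$ (for $n = 0$ this is $2^{\aleph_0}$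 itself) does not belong to $\mathrm{WCS}(\mathcal{L}^{\mathrm{II}})$. -/

import Mathlib

open Cardinal

universe u

/-! ### Monadic second-order logic with full semantics -/

/-- Formulas of monadic second-order logic in the signature `L`, whose free first-order variables
are among `x_0, …, x_{n-1}` and whose free second-order variables are among `X_0, …, X_{m-1}`.
The quantifier `all` binds the variable `x_n` and `allSet` binds the variable `X_m`.
The remaining connectives and the existential quantifiers are the usual abbreviations. -/
inductive MSOFormula (L : FirstOrder.Language.{u, u}) : ℕ → ℕ → Type u
  | falsum {n m : ℕ} : MSOFormula L n m
  | equal {n m : ℕ} (s t : L.Term (Fin n)) : MSOFormula L n m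
  | rel {n m k : ℕ} (R : L.Relations k) (ts : Fin k → L.Term (Fin n)) : MSOFormula L n m
  | mem {n m : ℕ} (x : Fin n) (X : Fin m) : MSOFormula L n m
  | imp {n m : ℕ} (φ ψ : MSOFormula L n m) : MSOFormula L n m
  | all {n m : ℕ} (φ : MSOFormula L (n + 1) m) : MSOFormula L n m
  | allSet {n m : ℕ} (φ : MSOFormula L n (m + 1)) : MSOFormula L n m

/-- Satisfaction of a monadic second-order formula: first-order variables range over the elements
of the structure, second-order variables over all subsets of its underlying set. -/
def MSOFormula.Realize {L : FirstOrder.Language.{u, u}} (M : Type u) [L.Structure M] :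
    {n m : ℕ} → MSOFormula L n m → (Fin n → M) → (Fin m → Set M) → Prop
  | _, _, .falsum, _, _ => False
  | _, _, .equal s t, v, _ => s.realize v = t.realize v
  | _, _, .rel R ts, v, _ => FirstOrder.Language.Structure.RelMap R fun i => (ts i).realize v
  | _, _, .mem x X, v, V => v x ∈ V X
  | _, _, .imp φ ψ, v, V => φ.Realize M v V → ψ.Realize M v V
  | n, _, .all φ, v, V => ∀ a : M, φ.Realize M (Fin.snoc (α := fun _ : Fin (n + 1) => M) v a) V
  | _, m, .allSet φ, v, V =>
      ∀ A : Set M, φ.Realize M v (Fin.snoc (α := fun _ : Fin (m + 1) => Set M) V A)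

/-- Sentences: formulas without free variables. -/
abbrev MSOSentence (L : FirstOrder.Language.{u, u}) : Type u := MSOFormula L 0 0

/-- The sentence `φ` holds in the structure `M`. -/
def MSOSentence.Holds {L : FirstOrder.Language.{u, u}} (M : Type u) [L.Structure M]
    (φ : MSOSentence L) : Prop :=
  MSOFormula.Realize M φ Fin.elim0 Fin.elim0

/-- A theory is satisfiable if all its sentences hold in some (nonempty) structure. -/
def MSOSatisfiable {L : FirstOrder.Language.{u, u}} (T : Set (MSOSentence L)) : Prop :=
  ∃ (M : Type u) (_ : Nonempty M) (_ : L.Structure M), ∀ φ ∈ T, MSOSentence.Holds M φ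

/-- A theory is `< κ`-satisfiable if all its subsets of cardinality `< κ` are satisfiable. -/
def MSOSatisfiableBelow {L : FirstOrder.Language.{u, u}} (κ : Cardinal.{u})
    (T : Set (MSOSentence L)) : Prop :=
  ∀ T₀ ⊆ T, #T₀ < κ → MSOSatisfiable T₀

/-- The weak compactness spectrum of monadic second-order logic. -/
def weakCompactnessSpectrum : Set Cardinal.{u} :=
  {κ | ℵ₀ < κ ∧ ∀ (L : FirstOrder.Language.{u, u}) (T : Set (MSOSentence L)),
    L.card ≤ κ → MSOSatisfiableBelow κ T → MSOSatisfiable T}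

/-- The weak compactness number of monadic second-order logic: the least element of the weak
compactness spectrum, and `∞` (that is, `⊤`) if the spectrum is empty. -/
noncomputable def weakCompactnessNumber : WithTop Cardinal.{u} :=
  sInf ((fun κ : Cardinal.{u} => (κ : WithTop Cardinal.{u})) '' weakCompactnessSpectrum)

/-! ### Weakly Mahlo and weakly hyper-Mahlo cardinals -/

/-- A cardinal is weakly inaccessible if it is an uncountable regular limit cardinal. -/
def IsWeaklyInaccessibleCardinal (κ : Cardinal.{u}) : Prop :=
  ℵ₀ < κ ∧ κ.IsRegular ∧ Order.IsSuccLimit κ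

/-- The cardinals `ν < κ` with property `P`, viewed as ordinals, form a stationary subset
of `κ`. -/
def StationaryBelow (P : Cardinal.{u} → Prop) (κ : Cardinal.{u}) : Prop :=
  IsStationary {o : Set.Iio κ.ord | ∃ ν : Cardinal.{u}, ν.ord = o.1 ∧ P ν}

/-- A cardinal is weakly Mahlo if it is weakly inaccessible and the weakly inaccessible cardinals
below it are stationary in it. -/
def IsWeaklyMahlo (κ : Cardinal.{u}) : Prop :=
  IsWeaklyInaccessibleCardinal κ ∧ StationaryBelow IsWeaklyInaccessibleCardinal κ

/-- `κ` is an `α`-fold stationary limit of cardinals with property `P`: it has property `P`, and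
for every `β < α` the `β`-fold stationary limits of cardinals with property `P` are stationary
in `κ`. -/
def StationaryLimit (P : Cardinal.{u} → Prop) (α : Ordinal.{u}) (κ : Cardinal.{u}) : Prop :=
  P κ ∧ ∀ β, β < α → StationaryBelow (fun ν => StationaryLimit P β ν) κ
termination_by α

/-- The hierarchy weakly Mahlo, weakly hyper-Mahlo, weakly hyper-hyper-Mahlo, and so on: at each
step one passes from a property `P` to those `κ` that are `κ`-fold stationary limits of cardinals
with property `P`. -/
def IsWeaklyHyperMahlo : ℕ → Cardinal.{u} → Prop
  | 0 => IsWeaklyMahlo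
  | i + 1 => fun κ => StationaryLimit (IsWeaklyHyperMahlo i) κ.ord κ

open Order Set Filter FirstOrder

/-! For (1), let κ be the least element of the spectrum. No smaller cardinal belongs to it, so every
nonzero δ < κ carries a theory indexed by δ whose proper initial segments have models while the
whole has none (`hasLimitTheory_of_lt`). Put into one structure the order κ with names for its
elements, κ many functions, and for all a < δ a model of the first a sentences of the δ-th theory.
Compactness yields a structure satisfying the common theory and containing an unnamed point. Its
order is well-founded, and no unnamed point lies below a named one: for the least such name δ, it
would index a model of the entire δ-th theory. Hence the least unnamed point x has exactly the named
points below it, and a function that is regressive at x takes a named value there. The sets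
definable from the language and containing x generate a filter, and any ultrafilter extending it
makes the given functions constant whenever they are regressive
(`exists_ultrafilter_of_mem_weakCompactnessSpectrum`, `hasNormalUltrafilters_of_isLeast`).

Normality for κ prescribed functions is enough for the classical arguments about normal measures.
What holds almost everywhere is stationary in κ (`Reflects.stationaryBelow`), and stationarity in κ
passes to almost every ν < κ (`Reflects.of_stationaryBelow`). Almost every ν is weakly inaccessible,
and alternating the two facts climbs the Mahlo hierarchy.

For (2), a structure with a sort for each $(2^{\aleph_0})^{+m}$ is pinned down by its theory
together with names for its elements: no model has an unnamed point in the n-th sort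
(`mk_sort_notMem_weakCompactnessSpectrum`). -/

/-- The ultrafilter `U` concentrates on `κ`, contains all final segments of `κ`, and every function
in `F` that is regressive `U`-almost everywhere is constant `U`-almost everywhere. -/
structure IsNormalFor (κ : Cardinal.{u}) (F : Set (Ordinal.{u} → Ordinal.{u}))
    (U : Ultrafilter Ordinal.{u}) : Prop where
  eventually_lt : ∀ᶠ ν in (U : Filter Ordinal.{u}), ν < κ.ord
  eventually_gt : ∀ α < κ.ord, ∀ᶠ ν in (U : Filter Ordinal.{u}), α < ν
  eventually_eq : ∀ f ∈ F, (∀ᶠ ν in (U : Filter Ordinal.{u}), f ν < ν) →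
    ∃ α < κ.ord, ∀ᶠ ν in (U : Filter Ordinal.{u}), f ν = α

/-- For any `κ` many functions there is an ultrafilter on `κ` which is normal for them. -/
def HasNormalUltrafilters (κ : Cardinal.{u}) : Prop :=
  ∀ F : Set (Ordinal.{u} → Ordinal.{u}), #F ≤ Cardinal.lift.{u + 1} κ → ∃ U, IsNormalFor κ F U

/-- The property `P` holds almost everywhere for all ultrafilters on `κ` that are normal for a
suitable family of `κ` many functions. -/
def Reflects (κ : Cardinal.{u}) (P : Ordinal.{u} → Prop) : Prop :=
  ∃ F : Set (Ordinal.{u} → Ordinal.{u}), #F ≤ Cardinal.lift.{u + 1} κ ∧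
    ∀ U, IsNormalFor κ F U → ∀ᶠ ν in (U : Filter Ordinal.{u}), P ν

/-! ### Normal ultrafilters and stationary sets -/

theorem IsNormalFor.mono {κ : Cardinal.{u}} {F G : Set (Ordinal.{u} → Ordinal.{u})}
    {U : Ultrafilter Ordinal.{u}} (h : IsNormalFor κ G U) (hFG : F ⊆ G) : IsNormalFor κ F U :=
  ⟨h.1, h.2, fun f hf => h.3 f (hFG hf)⟩

/-- A function bounded by δ < κ is regressive beyond δ, and its almost constant value is attained
somewhere, hence lies below δ. This replaces κ-completeness of the ultrafilter. -/
theorem IsNormalFor.const_eq {κ : Cardinal.{u}} {F : Set (Ordinal.{u} → Ordinal.{u})}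
    {U : Ultrafilter Ordinal.{u}} (h : IsNormalFor κ F U) {f : Ordinal.{u} → Ordinal.{u}}
    (hf : f ∈ F) {δ : Ordinal.{u}} (hδ : δ < κ.ord) (hlt : ∀ᶠ ν in (U : Filter Ordinal.{u}), f ν < δ) :
    ∃ α < δ, ∀ᶠ ν in (U : Filter Ordinal.{u}), f ν = α := by
  obtain ⟨α, -, hα⟩ := h.3 f hf <| by
    filter_upwards [hlt, h.2 δ hδ] with ν h1 h2 using h1.trans h2
  obtain ⟨ν, h1, h2⟩ := (hlt.and hα).exists
  exact ⟨α, h2 ▸ h1, hα⟩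

section
variable {κ : Cardinal.{u}}

theorem mk_range_Iio_le (f : Set.Iio κ.ord → Ordinal.{u} → Ordinal.{u}) :
    #(Set.range f) ≤ Cardinal.lift.{u + 1} κ := by
  refine mk_range_le.trans ?_
  simp [mk_Iio_ordinal]

theorem mk_union_le_lift {F G : Set (Ordinal.{u} → Ordinal.{u})} (hκ : ℵ₀ ≤ κ)
    (hF : #F ≤ Cardinal.lift.{u + 1} κ) (hG : #G ≤ Cardinal.lift.{u + 1} κ) :
    #(F ∪ G : Set _) ≤ Cardinal.lift.{u + 1} κ :=
  (mk_union_le F G).trans ((add_le_add hF hG).trans_eq (add_eq_self (by simpa using hκ)))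

theorem mk_singleton_le_lift {f : Ordinal.{u} → Ordinal.{u}} (hκ : ℵ₀ ≤ κ) :
    #({f} : Set (Ordinal.{u} → Ordinal.{u})) ≤ Cardinal.lift.{u + 1} κ := by
  rw [mk_singleton, one_le_lift_iff]; exact one_le_aleph0.trans hκ

theorem Reflects.and {P Q : Ordinal.{u} → Prop} (hκ : ℵ₀ ≤ κ) (hP : Reflects κ P)
    (hQ : Reflects κ Q) : Reflects κ fun ν => P ν ∧ Q ν := by
  obtain ⟨F, hF, hF'⟩ := hP
  obtain ⟨G, hG, hG'⟩ := hQ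
  exact ⟨F ∪ G, mk_union_le_lift hκ hF hG, fun U hU =>
    (hF' U (hU.mono subset_union_left)).and (hG' U (hU.mono subset_union_right))⟩

theorem Reflects.mono {P Q : Ordinal.{u} → Prop} (hP : Reflects κ P)
    (h : ∀ ν < κ.ord, P ν → Q ν) : Reflects κ Q := by
  obtain ⟨F, hF, hF'⟩ := hP
  refine ⟨F, hF, fun U hU => ?_⟩
  filter_upwards [hF' U hU, hU.1] with ν h1 h2 using h ν h2 h1

theorem Reflects.gt {δ : Ordinal.{u}} (hδ : δ < κ.ord) : Reflects κ fun ν => δ < ν :=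
  ⟨∅, by simp, fun _ hU => hU.2 δ hδ⟩

theorem Reflects.exists_lt (hκ : HasNormalUltrafilters κ) {P : Ordinal.{u} → Prop}
    (hP : Reflects κ P) : ∃ ν < κ.ord, P ν := by
  obtain ⟨F, hF, hF'⟩ := hP
  obtain ⟨U, hU⟩ := hκ F hF
  obtain ⟨ν, h⟩ := (hU.1.and (hF' U hU)).exists
  exact ⟨ν, h⟩

/-- Otherwise a would be the supremum of the part of C below it and so belong to C. The bound serves
as a regressive function off the club. -/
theorem exists_bound_of_notMem {μ : Ordinal.{u}} {C : Set (Set.Iio μ)} (hC : IsClub C)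
    {a : Set.Iio μ} (ha : a ∉ C) (hne : ∃ x ∈ C, x < a) :
    ∃ j < a.1, ∀ x ∈ C, x < a → x.1 ≤ j := by
  by_contra! h
  obtain ⟨x₀, hx₀, hx₀a⟩ := hne
  refine ha (hC.isLUB_mem (t := {x | x ∈ C ∧ x < a}) (fun x hx => hx.1) ⟨x₀, hx₀, hx₀a⟩
    ⟨fun x hx => hx.2.le, fun b hb => ?_⟩)
  by_contra! hba
  obtain ⟨x, hx, hxa, hlt⟩ := h b.1 hba
  exact (hb ⟨hx, hxa⟩).not_gt hlt

/-- A property that reflects is stationary below `κ`. -/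
theorem Reflects.stationaryBelow (hκ : HasNormalUltrafilters κ) (hω : ℵ₀ ≤ κ)
    {P : Cardinal.{u} → Prop} (hP : Reflects κ fun ν => ∃ c : Cardinal.{u}, c.ord = ν ∧ P c) :
    StationaryBelow P κ := by
  intro C hC
  have hne : Nonempty (Set.Iio κ.ord) := ⟨⟨0, by
    simpa [Cardinal.ord_pos] using aleph0_pos.trans_le hω⟩⟩
  obtain ⟨c₀, hc₀⟩ := hC.nonempty
  have key : ∀ a : Ordinal.{u}, ∃ j, ∀ h : a < κ.ord, (⟨a, h⟩ : Set.Iio κ.ord) ∉ C → c₀.1 < a →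
      j < a ∧ ∀ x ∈ C, x.1 < a → x.1 ≤ j := by
    intro a
    by_cases H : ∃ h : a < κ.ord, (⟨a, h⟩ : Set.Iio κ.ord) ∉ C ∧ c₀.1 < a
    · obtain ⟨h, h1, h2⟩ := H
      obtain ⟨j, hj⟩ := exists_bound_of_notMem hC h1 ⟨c₀, hc₀, h2⟩
      exact ⟨j, fun _ _ _ => hj⟩
    · exact ⟨0, fun h h1 h2 => (H ⟨h, h1, h2⟩).elim⟩
  choose j hj using key
  obtain ⟨F, hF, hF'⟩ := hP
  obtain ⟨U, hU⟩ := hκ (F ∪ {j}) (mk_union_le_lift hω hF (mk_singleton_le_lift hω))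
  have hPU := hF' U (hU.mono subset_union_left)
  by_cases hCU : ∀ᶠ ν in (U : Filter Ordinal.{u}), ∃ h : ν < κ.ord, (⟨ν, h⟩ : Set.Iio κ.ord) ∈ C
  · obtain ⟨ν, h1, h2, h3⟩ := (hPU.and hCU).exists
    exact ⟨_, h1, h3⟩
  · rw [← Ultrafilter.eventually_not] at hCU
    have hev : ∀ᶠ ν in (U : Filter Ordinal.{u}), j ν < ν ∧ ∀ x ∈ C, x.1 < ν → x.1 ≤ j ν := by
      filter_upwards [hCU, hU.1, hU.2 c₀.1 c₀.2] with ν h1 h2 h3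
      exact hj ν h2 (fun h => h1 ⟨h2, h⟩) h3
    -- If C is null, the bounds j ν have a constant value α, so C has no elements above α, although
    -- it is unbounded.
    obtain ⟨α, hα, hα'⟩ := hU.3 j (by simp) (hev.mono fun _ h => h.1)
    have hα1 : Order.succ α < κ.ord := (isSuccLimit_ord hω).succ_lt hα
    obtain ⟨x, hx, hαx⟩ := hC.isCofinal ⟨_, hα1⟩
    obtain ⟨ν, h1, h2, h3⟩ := (hev.and (hα'.and (hU.2 x.1 x.2))).exists
    have := h1.2 x hx h3
    rw [h2] at this
    exact absurd (Order.succ_le_iff.1 (show Order.succ α ≤ x.1 from hαx)) this.not_gt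

/-- If all `P γ` are stationary below `κ`, then this reflects. -/
theorem Reflects.of_stationaryBelow (hω : ℵ₀ ≤ κ) {P : Ordinal.{u} → Cardinal.{u} → Prop}
    {β : Ordinal.{u}} (hP : ∀ γ < β, StationaryBelow (P γ) κ) :
    Reflects κ fun ν => ∀ c : Cardinal.{u}, c.ord = ν →
      ∀ γ < β, γ < ν → StationaryBelow (P γ) c := by
  classical
  let Bad : Ordinal.{u} → Ordinal.{u} → Prop := fun ν γ =>
    ∃ C : Set (Set.Iio ν), γ < β ∧ γ < ν ∧ IsClub C ∧ ∀ x ∈ C, ∀ c : Cardinal.{u}, c.ord = x.1 → ¬ P γ c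
  have hbad : ∀ ν, ∃ γ, ∃ C : Set (Set.Iio ν), (∃ γ', Bad ν γ') → (γ < β ∧ γ < ν ∧ IsClub C ∧
      ∀ x ∈ C, ∀ c : Cardinal.{u}, c.ord = x.1 → ¬ P γ c) := by
    intro ν
    by_cases H : ∃ γ', Bad ν γ'
    · obtain ⟨γ, C, h⟩ := H
      exact ⟨γ, C, fun _ => h⟩
    · exact ⟨0, ∅, fun h => (H h).elim⟩
  choose γ C hC using hbad
  -- the least elements of the clubs above a given ordinal
  have hh : ∀ ξ ν : Ordinal.{u}, ∃ y, (∃ γ', Bad ν γ') → ξ < ν →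
      ξ ≤ y ∧ ∃ h : y < ν, (⟨y, h⟩ : Set.Iio ν) ∈ C ν := by
    intro ξ ν
    by_cases H : (∃ γ', Bad ν γ') ∧ ξ < ν
    · obtain ⟨y, hy, hξ⟩ := (hC ν H.1).2.2.1.isCofinal ⟨ξ, H.2⟩
      exact ⟨y.1, fun _ _ => ⟨hξ, y.2, hy⟩⟩
    · exact ⟨0, fun h h' => (H ⟨h, h'⟩).elim⟩
  choose h hh using hh
  -- bounds of the clubs below a limit point which does not belong to them
  have hj : ∀ a ν : Ordinal.{u}, ∃ j, (∃ γ', Bad ν γ') → ∀ ha : a < ν,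
      (⟨a, ha⟩ : Set.Iio ν) ∉ C ν → (∃ x ∈ C ν, x.1 < a) →
      j < a ∧ ∀ x ∈ C ν, x.1 < a → x.1 ≤ j := by
    intro a ν
    by_cases H : (∃ γ', Bad ν γ') ∧ ∃ ha : a < ν, (⟨a, ha⟩ : Set.Iio ν) ∉ C ν ∧ ∃ x ∈ C ν, x.1 < a
    · obtain ⟨h1, h2, h3, h4⟩ := H
      obtain ⟨j, hj⟩ := exists_bound_of_notMem (hC ν h1).2.2.1 h3 h4
      exact ⟨j, fun _ _ _ _ => hj⟩
    · exact ⟨0, fun h1 h2 h3 h4 => (H ⟨h1, h2, h3, h4⟩).elim⟩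
  choose j hj using hj
  refine ⟨{γ} ∪ (Set.range (fun ξ : Set.Iio κ.ord => h ξ.1) ∪
    Set.range (fun ξ : Set.Iio κ.ord => j ξ.1)), mk_union_le_lift hω (mk_singleton_le_lift hω)
      (mk_union_le_lift hω (mk_range_Iio_le _) (mk_range_Iio_le _)), fun U hU => ?_⟩
  by_contra hcon
  rw [← Ultrafilter.eventually_not] at hcon
  have hB : ∀ᶠ ν in (U : Filter Ordinal.{u}), ∃ γ', Bad ν γ' := by
    filter_upwards [hcon] with ν hν
    push Not at hν
    obtain ⟨c, rfl, γ', h1, h2, h3⟩ := hν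
    rw [StationaryBelow, not_isStationary_iff] at h3
    obtain ⟨t, ht, hd⟩ := h3
    exact ⟨γ', t, h1, h2, ht, fun x hx c hc hP => Set.disjoint_left.1 hd ⟨c, hc, hP⟩ hx⟩
  obtain ⟨γ₀, -, hγ₀⟩ := hU.3 γ (by simp) (hB.mono fun ν hν => (hC ν hν).2.1)
  have hγ₀β : γ₀ < β := by
    obtain ⟨ν, h1, h2⟩ := (hB.and hγ₀).exists
    exact h2 ▸ (hC ν h1).1
  -- The limit of the clubs C ν along U. Constancy of the functions h ξ makes it unbounded,
  -- constancy of the j ξ makes it closed. A point of D in P γ₀ then lies in some C ν that avoids P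
  -- γ₀.
  let D : Set (Set.Iio κ.ord) := {ξ | ∀ᶠ ν in (U : Filter Ordinal.{u}),
    ∃ hξ : ξ.1 < ν, (⟨ξ.1, hξ⟩ : Set.Iio ν) ∈ C ν}
  have hD : IsClub D := by
    refine ⟨fun t htD htne _ a ha => ?_, fun ξ => ?_⟩
    · by_contra haD
      have hat : a ∉ t := fun h => haD (htD h)
      have hlt : ∀ x ∈ t, x < a := fun x hx => (ha.1 hx).lt_of_ne (by rintro rfl; exact hat hx)
      obtain ⟨x₀, hx₀⟩ := htne
      have haD' := Ultrafilter.eventually_not.2 haD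
      have hev : ∀ᶠ ν in (U : Filter Ordinal.{u}), j a.1 ν < a.1 ∧
          ∀ x ∈ C ν, x.1 < a.1 → x.1 ≤ j a.1 ν := by
        filter_upwards [hB, hU.2 a.1 a.2, haD', htD hx₀] with ν h1 h2 h3 h4
        exact hj a.1 ν h1 h2 (fun h => h3 ⟨h2, h⟩) ⟨_, h4.2, hlt _ hx₀⟩
      obtain ⟨α, hα, hα'⟩ := hU.const_eq (f := j a.1) (Or.inr (Or.inr ⟨a, rfl⟩)) a.2
        (hev.mono fun ν h => h.1)
      have : ¬ (⟨α, hα.trans a.2⟩ : Set.Iio κ.ord) ∈ upperBounds t := fun hub =>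
        (ha.2 hub).not_gt hα
      simp only [upperBounds, Set.mem_ofPred_eq, not_forall, not_le] at this
      obtain ⟨x, hx, hαx⟩ := this
      obtain ⟨ν, h1, h2, h3⟩ := (hev.and (hα'.and (htD hx))).exists
      have := h1.2 _ h3.2 (hlt x hx)
      rw [h2] at this
      exact this.not_gt hαx
    · have hev : ∀ᶠ ν in (U : Filter Ordinal.{u}), ξ.1 ≤ h ξ.1 ν ∧
          ∃ hy : h ξ.1 ν < ν, (⟨h ξ.1 ν, hy⟩ : Set.Iio ν) ∈ C ν := by
        filter_upwards [hB, hU.2 ξ.1 ξ.2] with ν h1 h2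
        exact hh ξ.1 ν h1 h2
      obtain ⟨α, hα, hα'⟩ := hU.3 (h ξ.1) (Or.inr (Or.inl ⟨ξ, rfl⟩)) (hev.mono fun ν h => h.2.1)
      refine ⟨⟨α, hα⟩, ?_, ?_⟩
      · filter_upwards [hev, hα'] with ν h1 h2
        subst h2
        exact h1.2
      · obtain ⟨ν, h1, h2⟩ := (hev.and hα').exists
        exact Subtype.mk_le_mk.2 (h2 ▸ h1.1)
  obtain ⟨ξ, ⟨c, hc, hPc⟩, hξ⟩ := hP γ₀ hγ₀β hD
  obtain ⟨ν, h1, h2, h3, h4⟩ := (hB.and (hγ₀.and hξ)).exists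
  exact (hC ν h1).2.2.2 _ h4 c hc (h2 ▸ hPc)

end

/-! ### Climbing the Mahlo hierarchy -/

section
variable {κ : Cardinal.{u}}

/-- Were κ singular, the index at which a short cofinal sequence passes ν would be constant for
almost every ν, bounding almost every ν by one term of the sequence. -/
theorem HasNormalUltrafilters.isRegular (hκ : HasNormalUltrafilters κ) (hω : ℵ₀ ≤ κ) :
    κ.IsRegular := by
  refine ⟨hω, ?_⟩
  by_contra! hlt
  have hμ : κ.ord.cof.ord < κ.ord := ord_lt_ord.2 hlt
  obtain ⟨g, hg⟩ := Ordinal.exists_isFundamentalSeq (o := κ.ord) rfl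
  have H : ∀ ν : Ordinal.{u}, ∃ i, ∀ _ : ν < κ.ord, ∃ h : i < κ.ord.cof.ord, ν ≤ (g ⟨i, h⟩).1 := by
    intro ν
    by_cases hν : ν < κ.ord
    · obtain ⟨_, ⟨i, rfl⟩, hi⟩ := hg.isCofinal_range ⟨ν, hν⟩
      exact ⟨i.1, fun _ => ⟨i.2, hi⟩⟩
    · exact ⟨0, fun h => (hν h).elim⟩
  choose i hi using H
  obtain ⟨U, hU⟩ := hκ {i} (mk_singleton_le_lift hω)
  obtain ⟨α, hα, hα'⟩ := hU.const_eq (f := i) rfl hμ (hU.1.mono fun ν h => (hi ν h).1)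
  obtain ⟨ν, h1, h2, h3⟩ := (hU.1.and (hα'.and (hU.2 _ (g ⟨α, hα⟩).2))).exists
  obtain ⟨h4, h5⟩ := hi ν h1
  simp only [h2] at h5
  exact h5.not_gt h3

/-- Otherwise the cofinality of ν is almost always a fixed η < κ, and each entry of the chosen
cofinal sequences is almost constant. These constants have a bound δ < κ by regularity; but the
index at which the sequence reaches δ + 1 is almost constant too. -/
theorem reflects_cof_eq (hκ : κ.IsRegular) : Reflects κ fun ν => ν.cof.ord = ν := by
  have hω := hκ.aleph0_le
  have H : ∀ ν : Ordinal.{u}, ∃ g : Ordinal.{u} → Ordinal.{u}, (∀ i < ν.cof.ord, g i < ν) ∧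
      ∀ x < ν, ∃ i < ν.cof.ord, x ≤ g i := by
    intro ν
    obtain ⟨g, hg⟩ := Ordinal.exists_isFundamentalSeq (o := ν) rfl
    refine ⟨fun i => if h : i < ν.cof.ord then (g ⟨i, h⟩).1 else 0, fun i hi => ?_, fun x hx => ?_⟩
    · simp only [hi, dif_pos]; exact (g ⟨i, hi⟩).2
    · obtain ⟨_, ⟨i, rfl⟩, hi⟩ := hg.isCofinal_range ⟨x, hx⟩
      refine ⟨i.1, i.2, ?_⟩
      beta_reduce
      rw [dif_pos (show i.1 < ν.cof.ord from i.2)]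
      exact hi
  choose g hg hg' using H
  have H : ∀ x ν : Ordinal.{u}, ∃ i, x < ν → i < ν.cof.ord ∧ x ≤ g ν i := by
    intro x ν
    by_cases h : x < ν
    · obtain ⟨i, hi⟩ := hg' ν x h
      exact ⟨i, fun _ => hi⟩
    · exact ⟨0, fun h' => (h h').elim⟩
  choose i hi using H
  refine ⟨{fun ν => ν.cof.ord} ∪ (Set.range (fun a : Set.Iio κ.ord => fun ν => g ν a.1) ∪
    Set.range (fun x : Set.Iio κ.ord => i x.1)), mk_union_le_lift hω (mk_singleton_le_lift hω)
      (mk_union_le_lift hω (mk_range_Iio_le _) (mk_range_Iio_le _)), fun U hU => ?_⟩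
  by_contra hcon
  rw [← Ultrafilter.eventually_not] at hcon
  obtain ⟨η, hη, hη'⟩ := hU.3 (fun ν => ν.cof.ord) (by simp) <| by
    filter_upwards [hcon] with ν hν using lt_of_le_of_ne (Ordinal.ord_cof_le ν) hν
  have H : ∀ a < η, ∃ α < κ.ord, ∀ᶠ ν in (U : Filter Ordinal.{u}), g ν a = α := by
    intro a ha
    refine hU.3 (fun ν => g ν a) (Or.inr (Or.inl ⟨⟨a, ha.trans hη⟩, rfl⟩)) ?_
    filter_upwards [hη'] with ν hν
    exact hg ν a (hν ▸ ha)
  choose! α hα hα' using H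
  -- the ultrafilter limits of the cofinal sequences are bounded below `κ`
  obtain ⟨δ, hδ, hδ'⟩ : ∃ δ < κ.ord, ∀ a < η, α a ≤ δ := by
    refine ⟨⨆ a : η.ToType, α a.toOrd.1, Ordinal.iSup_lt_of_lt_cof ?_ fun a => hα _ a.toOrd.2,
      fun a ha => ?_⟩
    · rw [hκ.cof_ord, mk_toType]; exact lt_ord.1 hη
    · have := Ordinal.le_iSup (fun a : η.ToType => α a.toOrd.1) (Ordinal.ToType.mk ⟨a, ha⟩)
      simpa using this
  have hδ1 : Order.succ δ < κ.ord := (isSuccLimit_ord hω).succ_lt hδ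
  obtain ⟨a, ha, ha'⟩ := hU.const_eq (f := i (Order.succ δ)) (Or.inr (Or.inr ⟨⟨_, hδ1⟩, rfl⟩)) hη <| by
    filter_upwards [hη', hU.2 _ hδ1] with ν h1 h2
    exact h1 ▸ (hi _ ν h2).1
  obtain ⟨ν, h1, h2, h3⟩ := (ha'.and ((hα' a ha).and (hU.2 _ hδ1))).exists
  have h4 := (hi _ ν h3).2
  rw [h1, h2] at h4
  exact (Order.succ_le_iff.1 h4).not_ge (hδ' a ha)

/-- If almost every ν were a successor cardinal, its predecessor would be almost constant and hence
ν itself, while U contains all final segments. -/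
theorem reflects_isWeaklyInaccessible (hκ : κ.IsRegular) (hω : ℵ₀ < κ) :
    Reflects κ fun ν => ∃ c : Cardinal.{u}, c.ord = ν ∧ IsWeaklyInaccessibleCardinal c := by
  have h0 := ((reflects_cof_eq hκ).and hκ.aleph0_le (Reflects.gt (ord_lt_ord.2 hω)))
  -- a successor cardinal is determined by its predecessor
  have H : ∀ ν : Ordinal.{u}, ∃ l : Ordinal.{u}, (∃ lam : Cardinal.{u}, (succ lam).ord = ν) →
      ∃ lam : Cardinal.{u}, (succ lam).ord = ν ∧ l = lam.ord := by
    intro ν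
    by_cases h : ∃ lam : Cardinal.{u}, (succ lam).ord = ν
    · obtain ⟨lam, h⟩ := h
      exact ⟨lam.ord, fun _ => ⟨lam, h, rfl⟩⟩
    · exact ⟨0, fun h' => (h h').elim⟩
  choose l hl using H
  have h1 : Reflects κ fun ν => ¬ ∃ lam : Cardinal.{u}, (succ lam).ord = ν := by
    refine ⟨{l}, mk_singleton_le_lift hω.le, fun U hU => ?_⟩
    rw [Ultrafilter.eventually_not]
    intro hcon
    obtain ⟨α, hα, hα'⟩ := hU.3 l rfl <| by
      filter_upwards [hcon] with ν hν
      obtain ⟨lam, rfl, h⟩ := hl ν hν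
      rw [h]
      exact ord_lt_ord.2 (lt_succ lam)
    have hev : ∀ᶠ ν in (U : Filter Ordinal.{u}), ν = (succ α.card).ord := by
      filter_upwards [hcon, hα'] with ν h1 h2
      obtain ⟨lam, rfl, h⟩ := hl ν h1
      rw [h2] at h
      rw [h, card_ord]
    obtain ⟨ν, h1, h2⟩ := (hev.and hU.1).exists
    obtain ⟨ν', h1', h2'⟩ := (hev.and (hU.2 ν h2)).exists
    exact h2'.ne (h1.trans h1'.symm)
  refine (h0.and hω.le h1).mono fun ν _ ⟨⟨h2, h3⟩, h4⟩ => ⟨ν.cof, h2, ?_, ?_, ?_⟩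
  · rw [← ord_lt_ord, h2]; exact h3
  · refine ⟨?_, (Ordinal.cof_ord_cof ν).ge⟩
    rw [← ord_le_ord, h2]; exact h3.le
  · have hne : ν.cof ≠ 0 := by
      rintro h
      rw [h, ord_zero] at h2
      exact not_lt_zero (h2 ▸ h3)
    refine ⟨by simpa [isMin_iff_eq_bot] using hne, ?_⟩
    intro lam hlam
    exact h4 ⟨lam, by rw [hlam.succ_eq, h2]⟩

theorem stationaryLimit_iff {P : Cardinal.{u} → Prop} {α : Ordinal.{u}} {c : Cardinal.{u}} :
    StationaryLimit P α c ↔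
      P c ∧ ∀ β, β < α → StationaryBelow (fun ν => StationaryLimit P β ν) c := by
  rw [StationaryLimit]

theorem Reflects.stationaryLimit (hκ : HasNormalUltrafilters κ) (hω : ℵ₀ ≤ κ)
    {P : Cardinal.{u} → Prop} (hP : Reflects κ fun ν => ∃ c : Cardinal.{u}, c.ord = ν ∧ P c)
    (β : Ordinal.{u}) (hβ : β < κ.ord) :
    Reflects κ fun ν => ∃ c : Cardinal.{u}, c.ord = ν ∧ StationaryLimit P β c := by
  induction β using WellFoundedLT.induction with
  | ind β ih =>
    have h1 := Reflects.of_stationaryBelow hω (P := fun γ c => StationaryLimit P γ c) (β := β)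
      fun γ hγ => (ih γ hγ (hγ.trans hβ)).stationaryBelow hκ hω
    refine ((hP.and hω h1).and hω (Reflects.gt hβ)).mono ?_
    rintro ν - ⟨⟨⟨c, rfl, hc⟩, h2⟩, h3⟩
    exact ⟨c, rfl, stationaryLimit_iff.2 ⟨hc, fun γ hγ => h2 c rfl γ hγ (hγ.trans h3)⟩⟩

/-- The diagonal case: reflection of a family indexed by all of κ gives, at almost every ν, the
members with index below ν, which is what being a ν-fold limit asks. -/
theorem Reflects.stationaryLimit_self (hκ : HasNormalUltrafilters κ) (hω : ℵ₀ ≤ κ)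
    {P : Cardinal.{u} → Prop} (hP : Reflects κ fun ν => ∃ c : Cardinal.{u}, c.ord = ν ∧ P c) :
    Reflects κ fun ν => ∃ c : Cardinal.{u}, c.ord = ν ∧ StationaryLimit P c.ord c := by
  have h1 := Reflects.of_stationaryBelow hω (P := fun γ c => StationaryLimit P γ c) (β := κ.ord)
      fun γ hγ => (hP.stationaryLimit hκ hω γ hγ).stationaryBelow hκ hω
  refine (hP.and hω h1).mono ?_
  rintro ν hν ⟨⟨c, rfl, hc⟩, h2⟩
  exact ⟨c, rfl, stationaryLimit_iff.2 ⟨hc, fun γ hγ => h2 c rfl γ (hγ.trans hν) hγ⟩⟩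

theorem reflects_isWeaklyHyperMahlo (hκ : HasNormalUltrafilters κ) (hω : ℵ₀ < κ) (i : ℕ) :
    Reflects κ fun ν => ∃ c : Cardinal.{u}, c.ord = ν ∧ IsWeaklyHyperMahlo i c := by
  induction i with
  | zero =>
    have hWI := reflects_isWeaklyInaccessible (hκ.isRegular hω.le) hω
    -- A single property is treated as a constant family of length 1, of which only index 0 is used.
    have h1 := Reflects.of_stationaryBelow hω.le (P := fun _ c => IsWeaklyInaccessibleCardinal c)
      (β := 1) fun _ _ => hWI.stationaryBelow hκ hω.le
    refine (hWI.and hω.le h1).mono ?_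
    rintro ν - ⟨⟨c, rfl, hc⟩, h2⟩
    exact ⟨c, rfl, hc, h2 c rfl 0 one_pos (ord_pos.2 (aleph0_pos.trans hc.1))⟩
  | succ i ih => exact ih.stationaryLimit_self hκ hω.le

/-- Below a cardinal with normal ultrafilters there are iterated stationary limits of weakly
hyper-Mahlo cardinals. -/
theorem HasNormalUltrafilters.exists_stationaryLimit_lt (hκ : HasNormalUltrafilters κ)
    (hω : ℵ₀ < κ) (i k : ℕ) : ∃ ν < κ, StationaryLimit (IsWeaklyHyperMahlo i) k ν := by
  obtain ⟨_, h, c, rfl, hc⟩ := ((reflects_isWeaklyHyperMahlo hκ hω i).stationaryLimit hκ hω.le k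
    (by rw [← ord_natCast, ord_lt_ord]; exact natCast_lt_aleph0.trans hω)).exists_lt hκ
  exact ⟨c, ord_lt_ord.1 h, hc⟩

end

/-! ### Derived connectives and the compactness principle -/

namespace MSOFormula
variable {L : FirstOrder.Language.{u, u}} {n m : ℕ}

/-- Negation. -/
def not (φ : MSOFormula L n m) : MSOFormula L n m := .imp φ .falsum

/-- Conjunction. -/
def and (φ ψ : MSOFormula L n m) : MSOFormula L n m := (φ.imp ψ.not).not

/-- Disjunction. -/
def or (φ ψ : MSOFormula L n m) : MSOFormula L n m := φ.not.imp ψ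

/-- Existential first-order quantification. -/
def ex (φ : MSOFormula L (n + 1) m) : MSOFormula L n m := φ.not.all.not

/-- Atomic formula for a unary relation symbol. -/
def rel₁ (R : L.Relations 1) (t : L.Term (Fin n)) : MSOFormula L n m := .rel R ![t]

/-- Atomic formula for a binary relation symbol. -/
def rel₂ (R : L.Relations 2) (s t : L.Term (Fin n)) : MSOFormula L n m := .rel R ![s, t]

variable {M : Type u} [L.Structure M] {v : Fin n → M} {V : Fin m → Set M}

@[simp] theorem realize_falsum : (falsum : MSOFormula L n m).Realize M v V ↔ False := Iff.rfl

@[simp] theorem realize_equal {s t : L.Term (Fin n)} :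
    (equal s t : MSOFormula L n m).Realize M v V ↔ s.realize v = t.realize v := Iff.rfl

@[simp] theorem realize_rel {k : ℕ} {R : L.Relations k} {ts : Fin k → L.Term (Fin n)} :
    (rel R ts : MSOFormula L n m).Realize M v V ↔
      FirstOrder.Language.Structure.RelMap R fun i => (ts i).realize v := Iff.rfl

@[simp] theorem realize_mem {x : Fin n} {X : Fin m} :
    (mem x X : MSOFormula L n m).Realize M v V ↔ v x ∈ V X := Iff.rfl

@[simp] theorem realize_imp {φ ψ : MSOFormula L n m} :
    (φ.imp ψ).Realize M v V ↔ (φ.Realize M v V → ψ.Realize M v V) := Iff.rfl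

@[simp] theorem realize_all {φ : MSOFormula L (n + 1) m} :
    φ.all.Realize M v V ↔
      ∀ a : M, φ.Realize M (Fin.snoc (α := fun _ : Fin (n + 1) => M) v a) V := Iff.rfl

@[simp] theorem realize_allSet {φ : MSOFormula L n (m + 1)} :
    φ.allSet.Realize M v V ↔
      ∀ A : Set M, φ.Realize M v (Fin.snoc (α := fun _ : Fin (m + 1) => Set M) V A) := Iff.rfl

@[simp] theorem realize_not {φ : MSOFormula L n m} :
    φ.not.Realize M v V ↔ ¬ φ.Realize M v V := Iff.rfl

@[simp] theorem realize_and {φ ψ : MSOFormula L n m} :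
    (φ.and ψ).Realize M v V ↔ φ.Realize M v V ∧ ψ.Realize M v V := by
  simp [and]

@[simp] theorem realize_or {φ ψ : MSOFormula L n m} :
    (φ.or ψ).Realize M v V ↔ φ.Realize M v V ∨ ψ.Realize M v V := by
  simp [or, or_iff_not_imp_left]

@[simp] theorem realize_ex {φ : MSOFormula L (n + 1) m} :
    φ.ex.Realize M v V ↔
      ∃ a : M, φ.Realize M (Fin.snoc (α := fun _ : Fin (n + 1) => M) v a) V := by
  simp [ex]

@[simp] theorem realize_rel₁ {R : L.Relations 1} {t : L.Term (Fin n)} :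
    (rel₁ R t : MSOFormula L n m).Realize M v V ↔
      FirstOrder.Language.Structure.RelMap R ![t.realize v] := by
  rw [rel₁, realize_rel]
  refine iff_of_eq (congrArg _ (funext fun i => ?_))
  fin_cases i; rfl

@[simp] theorem realize_rel₂ {R : L.Relations 2} {s t : L.Term (Fin n)} :
    (rel₂ R s t : MSOFormula L n m).Realize M v V ↔
      FirstOrder.Language.Structure.RelMap R ![s.realize v, t.realize v] := by
  rw [rel₂, realize_rel]
  refine iff_of_eq (congrArg _ (funext fun i => ?_))
  fin_cases i <;> rfl

theorem holds_def {φ : MSOSentence L} :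
    MSOSentence.Holds M φ ↔ φ.Realize M Fin.elim0 Fin.elim0 := Iff.rfl

end MSOFormula

section
variable {M : Type u} (a b c : M) (v : Fin 0 → M)

@[simp] theorem snoc_zero_zero : Fin.snoc (α := fun _ : Fin 1 => M) v a 0 = a := rfl
@[simp] theorem snoc_snoc_zero :
    Fin.snoc (α := fun _ : Fin 2 => M) (Fin.snoc (α := fun _ : Fin 1 => M) v a) b 0 = a := rfl
@[simp] theorem snoc_snoc_one :
    Fin.snoc (α := fun _ : Fin 2 => M) (Fin.snoc (α := fun _ : Fin 1 => M) v a) b 1 = b := rfl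
@[simp] theorem snoc_snoc_snoc_zero :
    Fin.snoc (α := fun _ : Fin 3 => M) (Fin.snoc (α := fun _ : Fin 2 => M)
      (Fin.snoc (α := fun _ : Fin 1 => M) v a) b) c 0 = a := rfl
@[simp] theorem snoc_snoc_snoc_one :
    Fin.snoc (α := fun _ : Fin 3 => M) (Fin.snoc (α := fun _ : Fin 2 => M)
      (Fin.snoc (α := fun _ : Fin 1 => M) v a) b) c 1 = b := rfl
@[simp] theorem snoc_snoc_snoc_two :
    Fin.snoc (α := fun _ : Fin 3 => M) (Fin.snoc (α := fun _ : Fin 2 => M)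
      (Fin.snoc (α := fun _ : Fin 1 => M) v a) b) c 2 = c := rfl
end

/-- The compactness property in the form in which it is used: if each of the sentences `θ s` fails
precisely in the structure `A s`, then some structure satisfies all the `θ s` and all sentences
that hold in all the `A s`. -/
theorem exists_structure_of_mem_weakCompactnessSpectrum {κ : Cardinal.{u}}
    (hκ : κ ∈ weakCompactnessSpectrum) {L : FirstOrder.Language.{u, u}} (hL : L.card ≤ κ) {S : Type u}
    (hS : κ ≤ #S) (A : S → Type u) [hne : ∀ s, Nonempty (A s)] [inst : ∀ s, L.Structure (A s)]
    (θ : S → MSOSentence L)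
    (hA : ∀ s t, MSOSentence.Holds (A s) (θ t) ↔ s ≠ t) :
    ∃ (M : Type u) (_ : Nonempty M) (_ : L.Structure M),
      (∀ φ : MSOSentence L, (∀ s, MSOSentence.Holds (A s) φ) → MSOSentence.Holds M φ) ∧
      ∀ s, MSOSentence.Holds M (θ s) := by
  obtain ⟨M, hM, iM, h⟩ := hκ.2 L ({φ | ∀ s, MSOSentence.Holds (A s) φ} ∪ Set.range θ) hL <| by
    intro T₀ hT₀ hcard
    -- The sentences θ s are pairwise distinct and at least κ in number, so T₀ omits some θ s, and
    -- then A s is a model of T₀.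
    obtain ⟨s, hs⟩ : ∃ s, θ s ∉ T₀ := by
      by_contra! hall
      refine (hcard.trans_le hS).not_ge ?_
      exact mk_le_of_injective (f := fun s => (⟨θ s, hall s⟩ : T₀))
        fun s t hst => by_contra fun hne =>
          have e : θ s = θ t := congrArg Subtype.val hst
          (hA s s).1 (e ▸ (hA s t).2 hne) rfl
    refine ⟨A s, hne s, inst s, fun φ hφ => ?_⟩
    rcases hT₀ hφ with h | ⟨t, rfl⟩
    · exact h s
    · exact (hA s t).2 fun h => hs (h ▸ hφ)
  exact ⟨M, hM, iM, fun φ hφ => h φ (Or.inl hφ), fun s => h _ (Or.inr ⟨s, rfl⟩)⟩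

/-! ### Pinning down the successors of the continuum -/

/-- Function symbols: names for all elements of `B`, a further constant, a unary and a binary
function. -/
inductive PinFunctions (B : Type u) : ℕ → Type u
  | const (b : B) : PinFunctions B 0
  | new : PinFunctions B 0
  | next : PinFunctions B 1
  | app : PinFunctions B 2

/-- Relation symbols: a sort of natural numbers, sorts indexed by `ℕ`, an order relation and
a coding relation. -/
inductive PinRelations : ℕ → Type u
  | num : PinRelations 1
  | sort (m : ℕ) : PinRelations 1
  | lt : PinRelations 2
  | code : PinRelations 2

/-- The language in which cardinals `(2 ^ ℵ₀)^{+n}` are pinned down. -/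
def pinLanguage (B : Type u) : FirstOrder.Language.{u, u} :=
  ⟨PinFunctions B, PinRelations⟩

theorem card_pinLanguage_le {B : Type u} (hB : ℵ₀ ≤ #B) : (pinLanguage B).card ≤ #B := by
  have h1 : #(Σ l, (pinLanguage B).Functions l) ≤ #(B ⊕ ULift.{u} ℕ) := by
    refine mk_le_of_injective (f := fun x : Σ l, PinFunctions B l => match x with
      | ⟨_, .const b⟩ => .inl b
      | ⟨_, .new⟩ => .inr ⟨0⟩
      | ⟨_, .next⟩ => .inr ⟨1⟩
      | ⟨_, .app⟩ => .inr ⟨2⟩) ?_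
    rintro ⟨_, _ | _ | _ | _⟩ ⟨_, _ | _ | _ | _⟩ h <;> simp_all [← ULift.down_inj]
  have h2 : #(Σ l, (pinLanguage B).Relations l) ≤ #(ULift.{u} ℕ) := by
    refine mk_le_of_injective (f := fun x : Σ l, PinRelations.{u} l => match x with
      | ⟨_, .num⟩ => ⟨0⟩
      | ⟨_, .lt⟩ => ⟨1⟩
      | ⟨_, .code⟩ => ⟨2⟩
      | ⟨_, .sort m⟩ => ⟨m + 3⟩) ?_
    rintro ⟨_, _ | _ | _ | _⟩ ⟨_, _ | _ | _ | _⟩ h <;> simp_all [← ULift.down_inj]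
  have h3 : #(B ⊕ ULift.{u} ℕ) ≤ #B := by
    simp [add_eq_left hB hB]
  have h4 := (add_le_add (h1.trans h3) (h2.trans (by simpa using hB))).trans_eq (add_eq_self hB)
  rw [Language.card_eq_card_functions_add_card_relations]
  simpa using h4

/-- The data of a structure for `pinLanguage`. -/
structure PinData (B : Type u) where
  zero : B
  next : B → B
  app : B → B → B
  num : Set B
  sort : ℕ → Set B
  lt : B → B → Prop
  code : B → B → Prop

/-- The structure with the given data, in which `d` interprets the additional constant. -/
def PinModel {B : Type u} (_ : PinData B) (_ : B) : Type u := B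

section
variable {B : Type u} (p : PinData B) (d : B)

instance : (pinLanguage B).Structure (PinModel p d) where
  funMap := fun {n} f => match n, f with
    | _, .const b => fun _ => b
    | _, .new => fun _ => d
    | _, .next => fun x => p.next (x 0)
    | _, .app => fun x => p.app (x 0) (x 1)
  RelMap := fun {n} R => match n, R with
    | _, .num => fun x => x 0 ∈ p.num
    | _, .sort m => fun x => x 0 ∈ p.sort m
    | _, .lt => fun x => p.lt (x 0) (x 1)
    | _, .code => fun x => p.code (x 0) (x 1)

instance : Nonempty (PinModel p d) := ⟨d⟩

end

namespace Pin
section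
variable {B : Type u} (M : Type u) [(pinLanguage B).Structure M]

/-- The value of the name of `b`. -/
def cst (b : B) : M :=
  Language.Structure.funMap (L := pinLanguage B) (PinFunctions.const b) Fin.elim0

variable (B) in
/-- The value of the additional constant. -/
def new : M :=
  Language.Structure.funMap (L := pinLanguage B) (PinFunctions.new : PinFunctions B 0) Fin.elim0

variable {M}

variable (B) in
/-- The interpretation of the unary function. -/
def next (x : M) : M :=
  Language.Structure.funMap (L := pinLanguage B) (PinFunctions.next : PinFunctions B 1) ![x]

variable (B) in
/-- The interpretation of the binary function. -/
def app (x y : M) : M :=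
  Language.Structure.funMap (L := pinLanguage B) (PinFunctions.app : PinFunctions B 2) ![x, y]

variable (B) in
/-- The interpretation of the sort of natural numbers. -/
def num (x : M) : Prop :=
  Language.Structure.RelMap (L := pinLanguage B) (PinRelations.num : PinRelations 1) ![x]

variable (B) in
/-- The interpretation of the sorts. -/
def sort (m : ℕ) (x : M) : Prop :=
  Language.Structure.RelMap (L := pinLanguage B) (PinRelations.sort m : PinRelations 1) ![x]

variable (B) in
/-- The interpretation of the order. -/
def lt (x y : M) : Prop :=
  Language.Structure.RelMap (L := pinLanguage B) (PinRelations.lt : PinRelations 2) ![x, y]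

variable (B) in
/-- The interpretation of the coding relation. -/
def code (x y : M) : Prop :=
  Language.Structure.RelMap (L := pinLanguage B) (PinRelations.code : PinRelations 2) ![x, y]

end

section
variable {B : Type u} {n m : ℕ}

def tCst (b : B) : (pinLanguage B).Term (Fin n) := .func (PinFunctions.const b) Fin.elim0
def tNew : (pinLanguage B).Term (Fin n) := .func (PinFunctions.new : PinFunctions B 0) Fin.elim0
def tNext (t : (pinLanguage B).Term (Fin n)) : (pinLanguage B).Term (Fin n) :=
  .func (PinFunctions.next : PinFunctions B 1) ![t]
def tApp (s t : (pinLanguage B).Term (Fin n)) : (pinLanguage B).Term (Fin n) :=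
  .func (PinFunctions.app : PinFunctions B 2) ![s, t]
def fNum (t : (pinLanguage B).Term (Fin n)) : MSOFormula (pinLanguage B) n m :=
  .rel₁ (L := pinLanguage B) PinRelations.num t
def fSort (k : ℕ) (t : (pinLanguage B).Term (Fin n)) : MSOFormula (pinLanguage B) n m :=
  .rel₁ (L := pinLanguage B) (PinRelations.sort k) t
def fLt (s t : (pinLanguage B).Term (Fin n)) : MSOFormula (pinLanguage B) n m :=
  .rel₂ (L := pinLanguage B) PinRelations.lt s t
def fCode (s t : (pinLanguage B).Term (Fin n)) : MSOFormula (pinLanguage B) n m :=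
  .rel₂ (L := pinLanguage B) PinRelations.code s t

variable {M : Type u} [(pinLanguage B).Structure M] {v : Fin n → M} {V : Fin m → Set M}
  {s t : (pinLanguage B).Term (Fin n)}

@[simp] theorem realize_tCst {b : B} :
    (tCst b : (pinLanguage B).Term (Fin n)).realize v = cst M b :=
  congrArg (Language.Structure.funMap (L := pinLanguage B) (PinFunctions.const b)) (Subsingleton.elim _ _)
@[simp] theorem realize_tNew : (tNew : (pinLanguage B).Term (Fin n)).realize v = new B M :=
  congrArg (Language.Structure.funMap (L := pinLanguage B) PinFunctions.new) (Subsingleton.elim _ _)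
@[simp] theorem realize_tNext : (tNext t).realize v = next B (t.realize v) :=
  congrArg _ (funext fun i => by fin_cases i; rfl)
@[simp] theorem realize_tApp : (tApp s t).realize v = app B (s.realize v) (t.realize v) :=
  congrArg _ (funext fun i => by fin_cases i <;> rfl)
@[simp] theorem realize_fNum :
    (fNum t : MSOFormula _ n m).Realize M v V ↔ num B (t.realize v) :=
  MSOFormula.realize_rel₁
@[simp] theorem realize_fSort {k : ℕ} :
    (fSort k t : MSOFormula _ n m).Realize M v V ↔ sort B k (t.realize v) :=
  MSOFormula.realize_rel₁
@[simp] theorem realize_fLt :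
    (fLt s t : MSOFormula _ n m).Realize M v V ↔ lt B (s.realize v) (t.realize v) :=
  MSOFormula.realize_rel₂
@[simp] theorem realize_fCode :
    (fCode s t : MSOFormula _ n m).Realize M v V ↔ code B (s.realize v) (t.realize v) :=
  MSOFormula.realize_rel₂
end
end Pin

-- The new constant must denote an element of sort n different from all named ones, but every
-- element of sort k ≤ n is named, by induction on k. An element of sort 0 is determined by the set
-- of numbers it codes, and every such set already has a named code. In sort k + 1 the predecessors
-- of a point are values of `app` on sort k: a point below a named one is therefore named, and a
-- point above all named ones would have too many predecessors.
open MSOFormula Pin Language in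
theorem mk_sort_notMem_weakCompactnessSpectrum {B : Type u} (p : PinData B) (n : ℕ)
    (h_zero : p.zero ∈ p.num) (h_next : ∀ x ∈ p.num, p.next x ∈ p.num)
    (h_ind : ∀ X : Set B, p.zero ∈ X → (∀ x ∈ X, p.next x ∈ X) → p.num ⊆ X)
    (h_ext : ∀ x ∈ p.sort 0, ∀ y ∈ p.sort 0, (∀ w ∈ p.num, p.code w x ↔ p.code w y) → x = y)
    (h_surj : ∀ X : Set B, ∃ x ∈ p.sort 0, ∀ w ∈ p.num, p.code w x ↔ w ∈ X)
    (h_tri : ∀ m ≤ n, ∀ x ∈ p.sort m, ∀ y ∈ p.sort m, p.lt x y ∨ x = y ∨ p.lt y x)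
    (h_app : ∀ m < n, ∀ x ∈ p.sort (m + 1), ∀ y ∈ p.sort (m + 1), p.lt y x →
      ∃ i ∈ p.sort m, y = p.app x i)
    (h_card : ∀ m < n, #(p.sort m) < #(p.sort (m + 1)))
    (hB : ℵ₀ ≤ #B) (hBn : #B ≤ #(p.sort n)) : #(p.sort n) ∉ weakCompactnessSpectrum := by
  intro hκ
  let L := pinLanguage B
  obtain ⟨M, _, iM, hM, hne⟩ := exists_structure_of_mem_weakCompactnessSpectrum hκ (L := L)
    ((card_pinLanguage_le hB).trans hBn) (S := p.sort n) le_rfl (fun s => PinModel p s.1)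
    (fun s => .not (.equal tNew (tCst s.1)))
    (fun s t => by
      simp only [holds_def, realize_not, realize_equal, realize_tNew, realize_tCst]
      exact not_congr (Subtype.ext_iff (a1 := s) (a2 := t)).symm)
  have e_next (b : B) : next B (cst M b) = cst M (p.next b) := by
    simpa [holds_def] using hM (.equal (tNext (tCst b)) (tCst (p.next b))) fun s => by
      simp [holds_def]; rfl
  have e_app (a b : B) : app B (cst M a) (cst M b) = cst M (p.app a b) := by
    simpa [holds_def] using hM (.equal (tApp (tCst a) (tCst b)) (tCst (p.app a b))) fun s => by
      simp [holds_def]; rfl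
  have e_inj (a b : B) (h : cst M a = cst M b) : a = b := by
    by_contra hab
    have := hM (.not (.equal (tCst a) (tCst b))) fun s => by
      simp [holds_def]; exact hab
    simp [holds_def, h] at this
  have e_sort (m : ℕ) (b : B) : sort B m (cst M b) ↔ b ∈ p.sort m := by
    constructor
    · intro h
      by_contra hb
      have := hM (.not (fSort m (tCst b))) fun s => by
        simp [holds_def]; exact hb
      simp [holds_def, h] at this
    · intro h
      simpa [holds_def] using hM (fSort m (tCst b)) fun s => by
        simp [holds_def]; exact h
  have e_num (b : B) (h : b ∈ p.num) : num B (cst M b) := by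
    simpa [holds_def] using hM (fNum (tCst b)) fun s => by
      simp [holds_def]; exact h
  have e_code (a b : B) : code B (cst M a) (cst M b) ↔ p.code a b := by
    constructor
    · intro h
      by_contra hb
      have := hM (.not (fCode (tCst a) (tCst b))) fun s => by
        simp [holds_def]; exact hb
      simp [holds_def, h] at this
    · intro h
      simpa [holds_def] using hM (fCode (tCst a) (tCst b)) fun s => by
        simp [holds_def]; exact h
  -- The only use of second-order quantification: induction makes every number of M a named one.
  have e_ind : ∀ X : Set M, cst M p.zero ∈ X → (∀ x ∈ X, next B x ∈ X) → ∀ x, num B x → x ∈ X := by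
    have := hM (.allSet (.imp (.all (.imp (.equal (.var 0) (tCst p.zero)) (.mem 0 0)))
      (.imp (.all (.imp (.mem 0 0) (.all (.imp (.equal (.var 1) (tNext (.var 0))) (.mem 1 0)))))
        (.all (.imp (fNum (.var 0)) (.mem 0 0)))))) fun s => by
      simp [holds_def]
      exact fun X h1 h2 => h_ind X h1 h2
    simpa [holds_def] using this
  have e_ext : ∀ x y : M, sort B 0 x → sort B 0 y →
      (∀ w : M, num B w → (code B w x → code B w y) ∧ (code B w y → code B w x)) → x = y := by
    have := hM (.all (.all (.imp (fSort 0 (.var 0)) (.imp (fSort 0 (.var 1))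
      (.imp (.all (.imp (fNum (.var 2)) (.and (.imp (fCode (.var 2) (.var 0)) (fCode (.var 2) (.var 1)))
        (.imp (fCode (.var 2) (.var 1)) (fCode (.var 2) (.var 0))))))
        (.equal (.var 0) (.var 1))))))) fun s => by
      simp only [holds_def, realize_all, realize_imp, realize_fSort, realize_fNum, realize_fCode,
        realize_and, realize_equal, Term.realize_var, snoc_snoc_snoc_zero, snoc_snoc_snoc_one,
        snoc_snoc_snoc_two, snoc_snoc_zero, snoc_snoc_one]
      exact fun x y hx hy h => h_ext x hx y hy fun w hw => ⟨(h w hw).1, (h w hw).2⟩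
    simpa only [holds_def, realize_all, realize_imp, realize_fSort, realize_fNum, realize_fCode,
        realize_and, realize_equal, Term.realize_var, snoc_snoc_snoc_zero, snoc_snoc_snoc_one,
        snoc_snoc_snoc_two, snoc_snoc_zero, snoc_snoc_one] using this
  have e_tri (k : ℕ) (hk : k ≤ n) : ∀ x y : M, sort B k x → sort B k y →
      lt B x y ∨ x = y ∨ lt B y x := by
    have := hM (.all (.all (.imp (fSort k (.var 0)) (.imp (fSort k (.var 1))
      (.or (fLt (.var 0) (.var 1)) (.or (.equal (.var 0) (.var 1)) (fLt (.var 1) (.var 0)))))))) fun s => by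
      simp [holds_def]
      exact fun x y hx hy => h_tri k hk x hx y hy
    simpa [holds_def] using this
  have e_lt (k : ℕ) (hk : k < n) : ∀ x y : M, sort B (k + 1) x → sort B (k + 1) y → lt B y x →
      ∃ i : M, sort B k i ∧ y = app B x i := by
    have := hM (.all (.all (.imp (fSort (k + 1) (.var 0)) (.imp (fSort (k + 1) (.var 1))
      (.imp (fLt (.var 1) (.var 0)) (.ex (.and (fSort k (.var 2))
        (.equal (.var 1) (tApp (.var 0) (.var 2)))))))))) fun s => by
      simp [holds_def]
      exact fun x y hx hy => h_app k hk x hx y hy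
    simpa [holds_def] using this
  have named (k : ℕ) (hk : k ≤ n) : ∀ x : M, sort B k x → ∃ b ∈ p.sort k, x = cst M b := by
    induction k with
    | zero =>
      intro x hx
      obtain ⟨b, hb, hb'⟩ := h_surj {w | code B (cst M w) x}
      refine ⟨b, hb, e_ext _ _ hx ((e_sort 0 b).2 hb) fun w hw => ?_⟩
      obtain ⟨w, hwp, rfl⟩ := e_ind {x | ∃ w ∈ p.num, x = cst M w} ⟨_, h_zero, rfl⟩
        (by rintro _ ⟨w, hw, rfl⟩; exact ⟨_, h_next w hw, e_next w⟩) w hw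
      rw [e_code]
      exact ⟨fun h => (hb' w hwp).2 h, fun h => (hb' w hwp).1 h⟩
    | succ k ih =>
      intro x hx
      by_cases H : ∃ b ∈ p.sort (k + 1), x = cst M b ∨ lt B x (cst M b)
      · obtain ⟨b, hb, rfl | h⟩ := H
        · exact ⟨b, hb, rfl⟩
        · obtain ⟨i, hi, rfl⟩ := e_lt k hk _ _ ((e_sort _ b).2 hb) hx h
          obtain ⟨a, ha, rfl⟩ := ih (Nat.le_of_succ_le hk) i hi
          rw [e_app, e_sort] at hx
          exact ⟨_, hx, e_app b a⟩
      -- Now x is above all named elements of its sort, so `app x` covers them by named elements of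
      -- sort k, contradicting `h_card`.
      · push Not at H
        have H' : ∀ b : p.sort (k + 1), ∃ a : p.sort k, cst M b.1 = app B x (cst M a.1) := by
          intro b
          obtain ⟨h1, h2⟩ := H b.1 b.2
          obtain h | h | h := e_tri _ hk x _ hx ((e_sort _ b.1).2 b.2)
          · exact (h2 h).elim
          · exact (h1 h).elim
          · obtain ⟨i, hi, h⟩ := e_lt k hk _ _ hx ((e_sort _ b.1).2 b.2) h
            obtain ⟨a, ha, rfl⟩ := ih (Nat.le_of_succ_le hk) i hi
            exact ⟨⟨a, ha⟩, h⟩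
        choose f hf using H'
        refine ((h_card k hk).not_ge (mk_le_of_injective (f := f) fun b c hbc => ?_)).elim
        exact Subtype.ext (e_inj _ _ ((hf b).trans (hbc ▸ (hf c).symm)))
  obtain ⟨b, hb, h⟩ := named n le_rfl (new B M) <| by
    have := hM (fSort n tNew) fun s => by
      simp [holds_def]
      exact s.2
    simpa [holds_def] using this
  have := hne ⟨b, hb⟩
  simp [holds_def, h] at this

theorem Cardinal.mk_sigma_nat_le {κ : Cardinal.{u}} (hκ : ℵ₀ ≤ κ) {C : ℕ → Type u}
    (h : ∀ n, #(C n) ≤ κ) : #(Σ n, C n) ≤ κ := by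
  rw [mk_sigma]
  refine (sum_le_sum _ _ h).trans ?_
  rw [Cardinal.sum_const, mk_nat, Cardinal.lift_aleph0, Cardinal.lift_uzero]
  exact (mul_le_mul_left hκ _).trans_eq (mul_eq_self hκ)

theorem Cardinal.exists_map_of_mk_le {B : Type u} {S T : Set B} (h : #S ≤ #T) :
    ∃ g : B → B, ∀ y ∈ S, ∃ i ∈ T, y = g i := by
  classical
  obtain ⟨f⟩ := h
  refine ⟨fun i => if h : ∃ y : S, (f y).1 = i then h.choose.1 else i, fun y hy =>
    ⟨(f ⟨y, hy⟩).1, (f ⟨y, hy⟩).2, ?_⟩⟩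
  have H : ∃ z : S, (f z).1 = (f ⟨y, hy⟩).1 := ⟨⟨y, hy⟩, rfl⟩
  beta_reduce
  rw [dif_pos H]
  exact (congrArg Subtype.val (f.injective (Subtype.ext H.choose_spec))).symm

/-- The structure is the disjoint union of ℕ and all the C m. Elements of C 0 code sets of numbers
via a bijection, and `app x` lists the predecessors of x in C (m + 1) by elements of C m. -/
theorem mk_notMem_weakCompactnessSpectrum (n : ℕ) (C : ℕ → Type u) [∀ m, LinearOrder (C m)]
    (h_zero : #(C 0) = 2 ^ ℵ₀) (h_lt : ∀ m < n, #(C m) < #(C (m + 1))) (h_le : ∀ m, #(C m) ≤ #(C n))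
    (h_Iio : ∀ m < n, ∀ x : C (m + 1), #(Set.Iio x) ≤ #(C m)) :
    #(C n) ∉ weakCompactnessSpectrum := by
  have hω : ℵ₀ ≤ #(C n) := (cantor ℵ₀).le.trans (h_zero.symm.trans_le (h_le 0))
  obtain ⟨e⟩ : Nonempty (C 0 ≃ Set (ULift.{u} ℕ)) := Cardinal.eq.1 (by simp [h_zero])
  let sort : ℕ → Set (ULift.{u} ℕ ⊕ Σ m, C m) := fun m => Set.range fun x : C m => .inr ⟨m, x⟩
  let lt : ULift.{u} ℕ ⊕ (Σ m, C m) → ULift.{u} ℕ ⊕ (Σ m, C m) → Prop := fun a b =>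
    ∃ (i : ℕ) (x y : C i), a = .inr ⟨i, x⟩ ∧ b = .inr ⟨i, y⟩ ∧ x < y
  have mk_sort (m : ℕ) : #(sort m) = #(C m) := mk_range_eq _ fun x y h => by simpa using h
  have happ : ∀ x, ∃ g : ULift.{u} ℕ ⊕ (Σ m, C m) → ULift.{u} ℕ ⊕ (Σ m, C m), ∀ m < n,
      x ∈ sort (m + 1) → ∀ y ∈ sort (m + 1), lt y x → ∃ i ∈ sort m, y = g i := by
    intro x
    by_cases H : ∃ m < n, x ∈ sort (m + 1)
    · obtain ⟨m, hm, x, rfl⟩ := H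
      have hle : #{y | lt y (.inr ⟨m + 1, x⟩)} ≤ #(sort m) := by
        rw [mk_sort m]
        refine le_trans (mk_le_of_surjective
          (f := fun z : Set.Iio x => ⟨.inr ⟨m + 1, z.1⟩, _, _, _, rfl, rfl, z.2⟩) ?_) (h_Iio m hm x)
        rintro ⟨_, i, y, z, rfl, h, hyz⟩
        simp only [Sum.inr.injEq, Sigma.mk.injEq] at h
        obtain ⟨rfl, h⟩ := h
        obtain rfl := eq_of_heq h
        exact ⟨⟨y, hyz⟩, rfl⟩
      obtain ⟨g, hg⟩ := Cardinal.exists_map_of_mk_le hle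
      refine ⟨g, fun k _ hk y _ hlt => ?_⟩
      obtain ⟨z, h⟩ := hk
      simp only [Sum.inr.injEq, Sigma.mk.injEq, Nat.add_right_cancel_iff] at h
      obtain ⟨rfl, -⟩ := h
      exact hg y hlt
    · exact ⟨id, fun m hm hx => (H ⟨m, hm, hx⟩).elim⟩
  choose app happ using happ
  let p : PinData (ULift.{u} ℕ ⊕ Σ m, C m) :=
    { zero := .inl ⟨0⟩
      next := Sum.elim (fun k => .inl ⟨k.down + 1⟩) .inr
      app := app
      num := Set.range .inl
      sort := sort
      lt := lt
      code := fun a b => ∃ x k, b = .inr ⟨0, x⟩ ∧ a = .inl k ∧ k ∈ e x }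
  have code_iff (k : ULift.{u} ℕ) (x : C 0) : p.code (.inl k) (.inr ⟨0, x⟩) ↔ k ∈ e x := by
    constructor
    · rintro ⟨y, l, h1, h2, h3⟩
      simp only [Sum.inr.injEq, Sigma.mk.injEq, true_and, Sum.inl.injEq] at h1 h2
      obtain rfl := eq_of_heq h1
      exact h2 ▸ h3
    · exact fun h => ⟨x, k, rfl, rfl, h⟩
  rw [← mk_sort n]
  refine mk_sort_notMem_weakCompactnessSpectrum p n ⟨_, rfl⟩ ?_ ?_ ?_ ?_ ?_ ?_ ?_ ?_ ?_
  · rintro _ ⟨k, rfl⟩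
    exact ⟨_, rfl⟩
  · rintro X h0 hs _ ⟨⟨k⟩, rfl⟩
    induction k with
    | zero => exact h0
    | succ k ih => exact hs _ ih
  · rintro _ ⟨x, rfl⟩ _ ⟨y, rfl⟩ h
    have : e x = e y := Set.ext fun k => by
      rw [← code_iff, ← code_iff]; exact h _ ⟨k, rfl⟩
    rw [e.injective this]
  · intro X
    refine ⟨.inr ⟨0, e.symm {k | .inl k ∈ X}⟩, ⟨_, rfl⟩, ?_⟩
    rintro _ ⟨k, rfl⟩
    rw [code_iff, e.apply_symm_apply]
    rfl
  · rintro m - _ ⟨x, rfl⟩ _ ⟨y, rfl⟩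
    obtain h | h | h := lt_trichotomy x y
    · exact Or.inl ⟨_, _, _, rfl, rfl, h⟩
    · exact Or.inr (Or.inl (by rw [h]))
    · exact Or.inr (Or.inr ⟨_, _, _, rfl, rfl, h⟩)
  · exact fun m hm x hx y hy h => happ x m hm hx y hy h
  · intro m hm
    exact (mk_sort m).trans_lt ((h_lt m hm).trans_eq (mk_sort (m + 1)).symm)
  · exact le_trans (by simp) (mk_le_of_injective (α := ULift.{u} ℕ)
      (β := ULift.{u} ℕ ⊕ Σ m, C m) (f := .inl) Sum.inl_injective)
  · refine le_trans ?_ (mk_sort n).ge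
    have h1 : #(ULift.{u} ℕ) ≤ #(C n) := by simpa using hω
    have h2 : #(Σ m, C m) ≤ #(C n) := mk_sigma_nat_le hω h_le
    rw [mk_sum, Cardinal.lift_id, Cardinal.lift_id]
    exact (add_le_add h1 h2).trans_eq (add_eq_self hω)

theorem succ_iterate_continuum_notMem_weakCompactnessSpectrum (n : ℕ) :
    (Order.succ^[n] (2 ^ ℵ₀ : Cardinal.{u})) ∉ weakCompactnessSpectrum.{u} := by
  let lam : ℕ → Cardinal.{u} := fun m => Order.succ^[m] (2 ^ ℵ₀)
  have lam_succ (m : ℕ) : lam (m + 1) = Order.succ (lam m) := Function.iterate_succ_apply' _ _ _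
  have lam_mono : Monotone lam := monotone_nat_of_le_succ fun m => by
    rw [lam_succ]; exact Order.le_succ _
  -- Sorts beyond n repeat the n-th one, so that the union of all sorts is no larger than it.
  have key := mk_notMem_weakCompactnessSpectrum n (fun m => (lam (min m n)).ord.ToType)
    (by simp [lam]) (fun m hm => ?_) (fun m => ?_) fun m hm x => ?_
  · simpa [lam] using key
  · simp only [mk_ord_toType, min_eq_left hm.le, min_eq_left (Nat.succ_le_of_lt hm), lam_succ]
    exact Order.lt_succ _
  · simpa using lam_mono (min_le_right m n)
  · have h : #(Set.Iio x) < lam (min (m + 1) n) := by simpa using mk_Iio_lt x (by simp)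
    simp only [min_eq_left (Nat.succ_le_of_lt hm)] at h
    rw [mk_ord_toType, min_eq_left hm.le, ← Order.lt_succ_iff, ← lam_succ]
    exact h

/-! ### The number of formulas -/

section
variable {L : FirstOrder.Language.{u, u}}

/-- Labels of the nodes of the syntax tree of a formula. -/
abbrev MSOLabel (L : FirstOrder.Language.{u, u}) : Type u :=
  (Σ n : ℕ, L.Term (Fin n) × L.Term (Fin n)) ⊕
    (Σ n k : ℕ, L.Relations k × (Fin k → L.Term (Fin n))) ⊕ ULift.{u} (ℕ × ℕ) ⊕ ULift.{u} (Fin 4)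

/-- The number of successors of a node of the syntax tree of a formula. -/
def MSOLabel.arity : MSOLabel L → ℕ
  | .inr (.inr (.inr ⟨1⟩)) => 2
  | .inr (.inr (.inr ⟨2⟩)) => 1
  | .inr (.inr (.inr ⟨3⟩)) => 1
  | _ => 0

/-- The syntax tree of a formula. -/
def MSOFormula.tree : {n m : ℕ} → MSOFormula L n m →
    WType fun a : MSOLabel L => ULift.{u} (Fin a.arity)
  | _, _, .falsum => ⟨.inr (.inr (.inr ⟨0⟩)), fun i => Fin.elim0 i.down⟩
  | n, _, .equal s t => ⟨.inl ⟨n, s, t⟩, fun i => Fin.elim0 i.down⟩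
  | n, _, .rel (k := k) R ts => ⟨.inr (.inl ⟨n, k, R, ts⟩), fun i => Fin.elim0 i.down⟩
  | _, _, .mem x X => ⟨.inr (.inr (.inl ⟨x, X⟩)), fun i => Fin.elim0 i.down⟩
  | _, _, .imp φ ψ => ⟨.inr (.inr (.inr ⟨1⟩)), fun i => if i.down.1 = 0 then φ.tree else ψ.tree⟩
  | _, _, .all φ => ⟨.inr (.inr (.inr ⟨2⟩)), fun _ => φ.tree⟩
  | _, _, .allSet φ => ⟨.inr (.inr (.inr ⟨3⟩)), fun _ => φ.tree⟩

theorem MSOFormula.tree_injective {n m : ℕ} :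
    Function.Injective (MSOFormula.tree : MSOFormula L n m → _) := by
  intro φ
  induction φ with
  | falsum => rintro (_ | _) h <;> simp_all [MSOFormula.tree]
  | equal s t => rintro (_ | _) h <;> simp_all [MSOFormula.tree]
  | rel R ts =>
    rintro (_ | _) h <;> simp_all [MSOFormula.tree]
    obtain ⟨⟨rfl, h⟩, -⟩ := h
    simpa using h
  | mem x X =>
    rintro (_ | _) h <;> simp_all [MSOFormula.tree]
    obtain ⟨⟨h, h'⟩, -⟩ := h
    exact ⟨Fin.ext h, Fin.ext h'⟩
  | imp φ ψ ih1 ih2 =>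
    rintro (_ | _) h <;> simp_all [MSOFormula.tree]
    exact ⟨ih1 (by simpa using congrFun h ⟨⟨0, two_pos⟩⟩),
      ih2 (by simpa using congrFun h ⟨⟨1, one_lt_two⟩⟩)⟩
  | all φ ih =>
    rintro (_ | _) h <;> simp_all [MSOFormula.tree]
    exact ih (congrFun h ⟨⟨0, one_pos⟩⟩)
  | allSet φ ih =>
    rintro (_ | _) h <;> simp_all [MSOFormula.tree]
    exact ih (congrFun h ⟨⟨0, one_pos⟩⟩)

theorem mk_functions_le_card : #(Σ n, L.Functions n) ≤ L.card :=
  mk_le_of_injective (f := Sum.inl) Sum.inl_injective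

theorem mk_relations_le_card : #(Σ n, L.Relations n) ≤ L.card :=
  mk_le_of_injective (f := Sum.inr) Sum.inr_injective

/-- Formulas embed into well-founded, finitely branching trees with at most κ labels. -/
theorem mk_msoFormula_le {κ : Cardinal.{u}} (hκ : ℵ₀ ≤ κ) (hL : L.card ≤ κ) (n m : ℕ) :
    #(MSOFormula L n m) ≤ κ := by
  have hT (n : ℕ) : #(L.Term (Fin n)) ≤ κ := by
    refine Language.Term.card_le.trans (max_le hκ ?_)
    rw [mk_sum, Cardinal.lift_id', mk_fin, lift_natCast]
    exact (add_le_add (natCast_lt_aleph0.le.trans hκ) (by simpa using mk_functions_le_card.trans hL)).trans_eq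
      (add_eq_self hκ)
  have hR (k : ℕ) : #(L.Relations k) ≤ κ :=
    (mk_le_of_injective (f := fun R => (⟨k, R⟩ : Σ n, L.Relations n))
      sigma_mk_injective).trans (mk_relations_le_card.trans hL)
  refine (mk_le_of_injective MSOFormula.tree_injective).trans
    (WType.cardinalMk_le_max_aleph0_of_finite.trans (max_le ?_ hκ))
  simp only [MSOLabel, mk_sum, Cardinal.lift_id]
  refine (add_le_add (mk_sigma_nat_le hκ fun n => ?_) ((add_le_add (mk_sigma_nat_le hκ fun n =>
    mk_sigma_nat_le hκ fun k => ?_) ((add_le_add (b := κ) (d := κ) ?_ ?_).trans_eq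
      (add_eq_self hκ))).trans_eq (add_eq_self hκ))).trans_eq (add_eq_self hκ)
  · rw [mk_prod]; simp only [Cardinal.lift_id]
    exact (mul_le_mul' (hT n) (hT n)).trans_eq (mul_eq_self hκ)
  · rw [mk_prod]; simp only [Cardinal.lift_id]
    refine (mul_le_mul' (hR k) ?_).trans_eq (mul_eq_self hκ)
    rw [mk_arrow, mk_fin, lift_natCast, Cardinal.lift_uzero, power_natCast]
    exact (pow_le_pow_left' (hT n) k).trans (power_nat_le hκ)
  · simpa using hκ
  · refine le_trans ?_ hκ; simp

end

/-! ### Unsatisfiable theories with satisfiable initial segments -/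

/-- There is a theory, increasing along `δ`, in a signature of size at most `κ`, whose proper initial
segments are satisfiable, but which is not satisfiable itself. -/
def HasLimitTheory (κ : Cardinal.{u}) (δ : Ordinal.{u}) : Prop :=
  ∃ (L : FirstOrder.Language.{u, u}) (_ : L.card ≤ κ) (φ : Ordinal.{u} → MSOSentence L),
    (∀ α < δ, MSOSatisfiable (φ '' Set.Iio α)) ∧ ¬ MSOSatisfiable (φ '' Set.Iio δ)

/-- A language with a binary relation symbol and countably many constants. -/
def chainLanguage : FirstOrder.Language.{u, u} where
  Functions := fun n => match n with
    | 0 => ULift.{u} ℕ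
    | _ + 1 => PEmpty
  Relations := fun n => match n with
    | 2 => PUnit
    | _ => PEmpty

theorem card_chainLanguage_le : chainLanguage.{u}.card ≤ ℵ₀ := by
  have h1 (n : ℕ) : #(chainLanguage.{u}.Functions n) ≤ ℵ₀ := by
    rcases n with _ | n
    · exact (mk_le_aleph0 (α := ULift.{u} ℕ))
    · exact (mk_le_aleph0 (α := PEmpty.{u + 1}))
  have h2 (n : ℕ) : #(chainLanguage.{u}.Relations n) ≤ ℵ₀ := by
    rcases n with _ | _ | _ | n
    · exact (mk_le_aleph0 (α := PEmpty.{u + 1}))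
    · exact (mk_le_aleph0 (α := PEmpty.{u + 1}))
    · exact (mk_le_aleph0 (α := PUnit.{u + 1}))
    · exact (mk_le_aleph0 (α := PEmpty.{u + 1}))
  rw [Language.card, Language.Symbols, mk_sum, Cardinal.lift_id, Cardinal.lift_id]
  exact (add_le_add (mk_sigma_nat_le le_rfl h1) (mk_sigma_nat_le le_rfl h2)).trans_eq
    (add_eq_self le_rfl)

/-- The structure on the natural numbers for `chainLanguage` in which the constants form
a descending chain of length `N`. -/
@[reducible] def chainStructure (N : ℕ) : chainLanguage.{u}.Structure (ULift.{u} ℕ) where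
  funMap := fun {n} => match n with
    | 0 => fun c _ => ⟨N - c.down⟩
    | _ + 1 => fun c _ => c.elim
  RelMap := fun {n} => match n with
    | 0 => fun c _ => c.elim
    | 1 => fun c _ => c.elim
    | 2 => fun _ x => (x 0).down < (x 1).down
    | _ + 3 => fun c _ => c.elim

theorem hasLimitTheory_one {κ : Cardinal.{u}} (hκ : ℵ₀ ≤ κ) : HasLimitTheory κ 1 := by
  refine ⟨chainLanguage, card_chainLanguage_le.trans hκ, fun _ => .falsum, fun α hα => ?_, ?_⟩
  · obtain rfl : α = 0 := by simpa using hα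
    refine ⟨ULift.{u} ℕ, ⟨⟨0⟩⟩, chainStructure 0, ?_⟩
    rintro _ ⟨i, hi, rfl⟩
    exact (not_lt_zero (show i < 0 from hi)).elim
  · rintro ⟨M, _, _, h⟩
    exact h _ ⟨0, show (0 : Ordinal.{u}) < 1 from one_pos, rfl⟩

open MSOFormula in
-- Descending chains of constants in a well-founded relation: every finite length occurs, an
-- infinite one does not. Well-foundedness is a monadic second-order sentence.
theorem hasLimitTheory_omega0 {κ : Cardinal.{u}} (hκ : ℵ₀ ≤ κ) :
    HasLimitTheory κ Ordinal.omega0 := by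
  let c (k : ℕ) : chainLanguage.{u}.Term (Fin 0) :=
    .func (l := 0) (show chainLanguage.{u}.Functions 0 from ULift.up k) Fin.elim0
  let lt : chainLanguage.{u}.Relations 2 := PUnit.unit
  let wf : MSOSentence chainLanguage.{u} := .allSet (.imp
    (.all (.imp (.all (.imp (.rel₂ lt (.var 1) (.var 0)) (.mem 1 0))) (.mem 0 0))) (.all (.mem 0 0)))
  let φ : ℕ → MSOSentence chainLanguage.{u} := fun k => wf.and (.rel₂ lt (c (k + 1)) (c k))
  refine ⟨chainLanguage, card_chainLanguage_le.trans hκ, fun o => φ o.card.toNat, fun α hα => ?_, ?_⟩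
  · obtain ⟨N, rfl⟩ := Ordinal.lt_omega0.1 hα
    let _ := chainStructure.{u} N
    refine ⟨ULift.{u} ℕ, ⟨⟨0⟩⟩, chainStructure N, ?_⟩
    rintro _ ⟨i, hi, rfl⟩
    obtain ⟨k, rfl⟩ := Ordinal.lt_omega0.1 (lt_trans hi hα)
    have hk : k < N := by simpa using hi
    simp only [Ordinal.card_nat, toNat_natCast, φ, wf, holds_def, realize_and, realize_allSet,
      realize_imp, realize_all, realize_rel₂, realize_mem]
    refine ⟨fun A hA ⟨a⟩ => ?_, show N - (k + 1) < N - k by omega⟩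
    induction a using Nat.strong_induction_on with
    | _ a ih => exact hA ⟨a⟩ fun b hb => ih b.down hb
  · rintro ⟨M, _, _, h⟩
    have h (k : ℕ) : MSOSentence.Holds M (φ k) := by
      have := h _ ⟨k, Ordinal.natCast_lt_omega0 k, rfl⟩
      simpa using this
    have h1 := h 0
    simp only [φ, wf, holds_def, realize_and, realize_allSet,
      realize_imp, realize_all, realize_rel₂, realize_mem] at h h1
    have h2 (k : ℕ) := (h k).2
    let x (k : ℕ) : M := (c k).realize Fin.elim0
    have h3 := h1.1 (Set.range x)ᶜ ?_ (x 0)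
    · exact h3 ⟨0, rfl⟩
    · rintro _ ha ⟨k, rfl⟩
      exact ha (x (k + 1)) (h2 k) ⟨k + 1, rfl⟩

/-- A theory refuting compactness at η has at most η sentences, so it can be enumerated along η;
each proper initial segment then has fewer than η sentences. -/
theorem hasLimitTheory_ord_of_notMem {κ η : Cardinal.{u}} (hη : ℵ₀ < η) (hηκ : η ≤ κ)
    (h : η ∉ weakCompactnessSpectrum) : HasLimitTheory κ η.ord := by
  have : ∃ (L : FirstOrder.Language.{u, u}) (T : Set (MSOSentence L)), L.card ≤ η ∧
      MSOSatisfiableBelow η T ∧ ¬ MSOSatisfiable T := by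
    by_contra! H
    exact h ⟨hη, H⟩
  obtain ⟨L, T, hL, hT, hT'⟩ := this
  obtain ⟨⟨φ₀, hφ₀⟩⟩ : Nonempty T := by
    by_contra hne
    rw [Set.nonempty_coe_sort, Set.not_nonempty_iff_eq_empty] at hne
    exact hT' (hT T le_rfl (by simpa [hne] using aleph0_pos.trans hη))
  have hle : #T ≤ #η.ord.ToType := by
    rw [mk_ord_toType]
    exact (mk_set_le T).trans (mk_msoFormula_le hη.le hL 0 0)
  obtain ⟨f⟩ := hle
  have : Nonempty T := ⟨⟨φ₀, hφ₀⟩⟩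
  let φ : Ordinal.{u} → MSOSentence L := fun i =>
    if h : i < η.ord then (Function.invFun f (Ordinal.ToType.mk ⟨i, h⟩)).1 else φ₀
  have hφ : φ '' Set.Iio η.ord = T := by
    ext ψ
    constructor
    · rintro ⟨i, hi, rfl⟩
      simp only [φ, dif_pos (show i < η.ord from hi)]
      exact Subtype.property _
    · intro hψ
      obtain ⟨i, hi⟩ := Function.invFun_surjective f.injective ⟨ψ, hψ⟩
      refine ⟨(Ordinal.ToType.toOrd i).1, (Ordinal.ToType.toOrd i).2, ?_⟩
      simp only [φ, dif_pos (show (Ordinal.ToType.toOrd i).1 < η.ord from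
        (Ordinal.ToType.toOrd i).2)]
      simp [hi]
  refine ⟨L, hL.trans hηκ, φ, fun α hα => hT _ (hφ ▸ Set.image_mono (Set.Iio_subset_Iio hα.le)) ?_,
    hφ.symm ▸ hT'⟩
  have := Cardinal.mk_image_le_lift (f := φ) (s := Set.Iio α)
  rw [mk_Iio_ordinal, Cardinal.lift_lift, Cardinal.lift_le] at this
  exact this.trans_lt (lt_ord.1 hα)

open MSOFormula in
theorem HasLimitTheory.of_cof {κ : Cardinal.{u}} {δ : Ordinal.{u}}
    (h : HasLimitTheory κ δ.cof.ord) : HasLimitTheory κ δ := by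
  classical
  obtain ⟨L, hL, φ, h1, h2⟩ := h
  obtain ⟨g, hg⟩ := Ordinal.exists_isFundamentalSeq (o := δ) rfl
  -- The theory is spread along a cofinal sequence in δ, with a tautology at all other indices.
  let ψ : Ordinal.{u} → MSOSentence L := fun β =>
    if h : ∃ i, (g i).1 = β then φ h.choose.1 else MSOFormula.falsum.not
  have hψ (i) : ψ (g i).1 = φ i.1 := by
    have H : ∃ j, (g j).1 = (g i).1 := ⟨i, rfl⟩
    have : H.choose = i := hg.strictMono.injective (Subtype.ext H.choose_spec)
    simp only [ψ, dif_pos H, this]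
  refine ⟨L, hL, ψ, fun α hα => ?_, fun ⟨M, hM, iM, h⟩ => h2 ⟨M, hM, iM, ?_⟩⟩
  · obtain ⟨_, ⟨j, rfl⟩, hj⟩ := hg.isCofinal_range ⟨α, hα⟩
    obtain ⟨M, hM, iM, h⟩ := h1 j.1 j.2
    refine ⟨M, hM, iM, ?_⟩
    rintro _ ⟨β, hβ, rfl⟩
    by_cases H : ∃ i, (g i).1 = β
    · obtain ⟨i, rfl⟩ := H
      rw [hψ]
      exact h _ ⟨i.1, hg.strictMono.lt_iff_lt.1 (lt_of_lt_of_le hβ hj), rfl⟩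
    · simp only [ψ, dif_neg H]
      exact fun h => h
  · rintro _ ⟨i, hi, rfl⟩
    exact hψ ⟨i, hi⟩ ▸ h _ ⟨_, (g ⟨i, hi⟩).2, rfl⟩

/-- Only the cofinality of δ matters: it is 1, ℵ₀, or an uncountable cardinal below κ, at which
compactness fails. -/
theorem hasLimitTheory_of_lt {κ : Cardinal.{u}} (hκ : ℵ₀ ≤ κ)
    (h : ∀ η < κ, η ∉ weakCompactnessSpectrum) {δ : Ordinal.{u}} (hδ : δ < κ.ord) (h0 : δ ≠ 0) :
    HasLimitTheory κ δ := by
  apply HasLimitTheory.of_cof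
  have hcof : δ.cof < κ := (Ordinal.cof_le_card δ).trans_lt (lt_ord.1 hδ)
  obtain h1 | h1 | h1 := lt_trichotomy δ.cof ℵ₀
  · have : δ.cof = 1 := le_antisymm (Ordinal.cof_lt_aleph0_iff.1 h1)
      (Cardinal.one_le_iff_ne_zero.2 (mt Ordinal.cof_eq_zero.1 h0))
    rw [this, ord_one]
    exact hasLimitTheory_one hκ
  · rw [h1, ord_aleph0]
    exact hasLimitTheory_omega0 hκ
  · exact hasLimitTheory_ord_of_notMem h1 hcof.le (h _ hcof)

/-! ### Relativisation -/

section
variable {L₀ L : FirstOrder.Language.{u, u}} (r : L.Functions 2)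
  (ff : ∀ k, L₀.Functions k → L.Functions (k + 1)) (rr : ∀ k, L₀.Relations k → L.Relations (k + 1))
  {n m : ℕ}

/-- The term that computes `t` in the structure with index `x_0`, whose underlying set is the range
of the retraction `r x_0`. -/
def FirstOrder.Language.Term.relativize : L₀.Term (Fin n) → L.Term (Fin (n + 1))
  | .var i => .var i.succ
  | .func (l := l) f ts =>
    .func r ![.var 0, .func (ff l f) (Fin.cons (.var 0) fun i => (ts i).relativize)]

/-- The formula that expresses `φ` in the structure with index `x_0`. -/
def MSOFormula.relativize : {n m : ℕ} → MSOFormula L₀ n m → MSOFormula L (n + 1) m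
  | _, _, .falsum => .falsum
  | _, _, .equal s t => .equal (s.relativize r ff) (t.relativize r ff)
  | _, _, .rel (k := k) R ts =>
    .rel (rr k R) (Fin.cons (.var 0) fun i => (ts i).relativize r ff)
  | _, _, .mem x X => .mem x.succ X
  | _, _, .imp φ ψ => .imp φ.relativize ψ.relativize
  | _, _, .all φ => .all (.imp (.equal (.func r ![.var 0, .var (Fin.last _)]) (.var (Fin.last _)))
      φ.relativize)
  | _, _, .allSet φ => .allSet φ.relativize

variable {r ff rr} {N M : Type u} [L₀.Structure N] [L.Structure M] {y : M} {emb : N → M}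

open FirstOrder.Language.Structure

theorem FirstOrder.Language.Term.realize_relativize
    (hf : ∀ k (f : L₀.Functions k) (z : Fin k → N),
      funMap r ![y, funMap (ff k f) (Fin.cons y (emb ∘ z) : Fin (k + 1) → M)] = emb (funMap f z))
    (t : L₀.Term (Fin n)) (v : Fin n → N) :
    (t.relativize r ff).realize (Fin.cons y (emb ∘ v) : Fin (n + 1) → M) = emb (t.realize v) := by
  induction t with
  | var i => simp [relativize]
  | func f ts ih =>
    rw [realize_func, ← hf, relativize, realize_func]
    congr 1
    funext i
    refine Fin.cases ?_ (fun i => ?_) i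
    · simp
    · have : i = 0 := Subsingleton.elim _ _
      subst this
      simp only [Matrix.cons_val_succ, Matrix.cons_val_zero, realize_func]
      congr 1
      funext j
      refine Fin.cases ?_ (fun j => ?_) j
      · simp
      · simpa using ih j

theorem MSOFormula.realize_relativize (hemb : Function.Injective emb)
    (hrange : ∀ x, funMap r ![y, x] = x ↔ x ∈ Set.range emb)
    (hf : ∀ k (f : L₀.Functions k) (z : Fin k → N),
      funMap r ![y, funMap (ff k f) (Fin.cons y (emb ∘ z) : Fin (k + 1) → M)] = emb (funMap f z))
    (hr : ∀ k (R : L₀.Relations k) (z : Fin k → N),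
      RelMap (rr k R) (Fin.cons y (emb ∘ z) : Fin (k + 1) → M) ↔ RelMap R z)
    (φ : MSOFormula L₀ n m) (v : Fin n → N) (V : Fin m → Set M) :
    (φ.relativize r ff rr).Realize M (Fin.cons y (emb ∘ v)) V ↔
      φ.Realize N v fun i => emb ⁻¹' V i := by
  induction φ with
  | falsum => exact Iff.rfl
  | equal s t =>
    simp only [relativize, realize_equal, Language.Term.realize_relativize hf, hemb.eq_iff]
  | @rel n m k R ts =>
    simp only [relativize, realize_rel]
    rw [← hr]
    refine iff_of_eq (congrArg _ (funext fun i => ?_))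
    refine Fin.cases ?_ (fun i => ?_) i
    · simp
    · simp [Language.Term.realize_relativize hf]
  | mem x X => simp [relativize]
  | imp φ ψ ih1 ih2 => simp only [relativize, realize_imp, ih1, ih2]
  | @all n m φ ih =>
    have key (x : M) : (equal (.func r ![.var 0, .var (Fin.last _)]) (.var (Fin.last _)) :
        MSOFormula L (n + 1 + 1) m).Realize M
          (Fin.snoc (α := fun _ => M) (Fin.cons y (emb ∘ v) : Fin (n + 1) → M) x) V ↔
        x ∈ Set.range emb := by
      rw [← hrange, realize_equal, Language.Term.realize_func, Language.Term.realize_var,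
        Fin.snoc_last]
      refine iff_of_eq (congrArg (· = x) (congrArg _ (funext fun i => ?_)))
      fin_cases i
      · change Fin.snoc (α := fun _ => M) (Fin.cons y (emb ∘ v) : Fin (n + 1) → M) x
          (Fin.castSucc 0) = y
        rw [Fin.snoc_castSucc]; rfl
      · exact Fin.snoc_last _ _
    simp only [relativize, realize_all, realize_imp, key]
    have key2 (a : N) : Fin.snoc (α := fun _ => M) (Fin.cons y (emb ∘ v) : Fin (n + 1) → M) (emb a) =
        (Fin.cons y (emb ∘ Fin.snoc (α := fun _ => N) v a) : Fin (n + 1 + 1) → M) := by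
      rw [← Fin.cons_snoc_eq_snoc_cons, Fin.comp_snoc]
    constructor
    · intro h a
      rw [← ih, ← key2]
      exact h _ ⟨a, rfl⟩
    · rintro h _ ⟨a, rfl⟩
      rw [key2, ih]
      exact h a
  | @allSet n m φ ih =>
    simp only [relativize, realize_allSet, ih]
    have key (A : Set M) : (fun i => emb ⁻¹' (Fin.snoc (α := fun _ => Set M) V A i)) =
        Fin.snoc (α := fun _ => Set N) (fun i => emb ⁻¹' V i) (emb ⁻¹' A) := by
      funext i
      refine Fin.lastCases ?_ (fun i => ?_) i <;> simp
    simp only [key]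
    -- Set quantifiers need no relativisation: only the trace of a set on the range of `emb` counts,
    -- and every subset of N is such a trace.
    refine ⟨fun h A => ?_, fun h A => h _⟩
    have := h (emb '' A)
    rwa [Set.preimage_image_eq A hemb] at this

end

/-! ### A structure that contains models of the initial segments of many theories -/

section
variable (K ι : Type u) (L' : K → FirstOrder.Language.{u, u})

/-- Function symbols: names for the elements of `K`, a further constant, unary functions, and for
each `δ` a retraction and the functions of `L' δ`, both with an additional argument. -/
inductive ExtFunctions : ℕ → Type u
  | const (a : K) : ExtFunctions 0
  | new : ExtFunctions 0
  | fn (i : ι) : ExtFunctions 1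
  | retr (δ : K) : ExtFunctions 2
  | sub (δ : K) (k : ℕ) (f : (L' δ).Functions k) : ExtFunctions (k + 1)

/-- Relation symbols: a predicate for `K`, its order, and for each `δ` the relations of `L' δ` with
an additional argument. -/
inductive ExtRelations : ℕ → Type u
  | ord : ExtRelations 1
  | lt : ExtRelations 2
  | sub (δ : K) (k : ℕ) (R : (L' δ).Relations k) : ExtRelations (k + 1)

/-- The language with these symbols. -/
def extLanguage : FirstOrder.Language.{u, u} := ⟨ExtFunctions K ι L', ExtRelations K L'⟩

variable {K ι L'}

theorem card_extLanguage_le {κ : Cardinal.{u}} (hκ : ℵ₀ ≤ κ) (hK : #K ≤ κ) (hι : #ι ≤ κ)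
    (hL : ∀ δ, (L' δ).card ≤ κ) : (extLanguage K ι L').card ≤ κ := by
  have add {a b : Cardinal.{u}} (ha : a ≤ κ) (hb : b ≤ κ) : a + b ≤ κ :=
    (add_le_add ha hb).trans_eq (add_eq_self hκ)
  have sig {C : K → Type u} (h : ∀ δ, #(C δ) ≤ κ) : #(Σ δ, C δ) ≤ κ := by
    rw [mk_sigma]
    refine (sum_le_sum _ _ h).trans ?_
    rw [Cardinal.sum_const]
    simp only [Cardinal.lift_id]
    exact (mul_le_mul' hK le_rfl).trans_eq (mul_eq_self hκ)
  have h1 : #(Σ n, (extLanguage K ι L').Functions n) ≤ κ := by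
    refine (mk_le_of_surjective (α := K ⊕ PUnit.{u + 1} ⊕ ι ⊕ K ⊕ Σ δ, Σ k, (L' δ).Functions k)
      (f := Sum.elim (fun a => ⟨0, .const a⟩) <| Sum.elim (fun _ => ⟨0, .new⟩) <|
        Sum.elim (fun i => ⟨1, .fn i⟩) <| Sum.elim (fun δ => ⟨2, .retr δ⟩)
        fun x => ⟨_, .sub x.1 x.2.1 x.2.2⟩) ?_).trans ?_
    · rintro ⟨_, a | _ | i | δ | ⟨δ, k, f⟩⟩
      · exact ⟨.inl a, rfl⟩
      · exact ⟨.inr (.inl ⟨⟩), rfl⟩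
      · exact ⟨.inr (.inr (.inl i)), rfl⟩
      · exact ⟨.inr (.inr (.inr (.inl δ))), rfl⟩
      · exact ⟨.inr (.inr (.inr (.inr ⟨δ, k, f⟩))), rfl⟩
    · simp only [mk_sum, Cardinal.lift_id]
      exact add hK (add ((mk_le_aleph0).trans hκ) (add hι (add hK
        (sig fun δ => mk_functions_le_card.trans (hL δ)))))
  have h2 : #(Σ n, (extLanguage K ι L').Relations n) ≤ κ := by
    refine (mk_le_of_surjective (α := PUnit.{u + 1} ⊕ PUnit.{u + 1} ⊕ Σ δ, Σ k, (L' δ).Relations k)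
      (f := Sum.elim (fun _ => ⟨1, .ord⟩) <| Sum.elim (fun _ => ⟨2, .lt⟩)
        fun x => ⟨_, .sub x.1 x.2.1 x.2.2⟩) ?_).trans ?_
    · rintro ⟨_, _ | _ | ⟨δ, k, f⟩⟩
      · exact ⟨.inl ⟨⟩, rfl⟩
      · exact ⟨.inr (.inl ⟨⟩), rfl⟩
      · exact ⟨.inr (.inr ⟨δ, k, f⟩), rfl⟩
    · simp only [mk_sum, Cardinal.lift_id]
      exact add ((mk_le_aleph0).trans hκ) (add ((mk_le_aleph0).trans hκ)
        (sig fun δ => mk_relations_le_card.trans (hL δ)))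
  rw [Language.card, Language.Symbols, mk_sum]
  simp only [Cardinal.lift_id]
  exact add h1 h2

variable (K ι L') in
/-- The data of a structure for `extLanguage`. -/
structure ExtData where
  sub : K → K → Type u
  nonempty : ∀ δ a, Nonempty (sub δ a)
  str : ∀ δ a, (L' δ).Structure (sub δ a)
  fn : ι → K → K

instance (p : ExtData K ι L') (δ a : K) : Nonempty (p.sub δ a) := p.nonempty δ a
instance (p : ExtData K ι L') (δ a : K) : (L' δ).Structure (p.sub δ a) := p.str δ a

/-- The structure with the given data, in which `d` interprets the additional constant. -/
def ExtModel (p : ExtData K ι L') (_ : K) : Type u := K ⊕ Σ q : K × K, p.sub q.1 q.2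

namespace ExtModel
variable {p : ExtData K ι L'} {d : K}

/-- The elements of `K` as elements of the structure. -/
def of (a : K) : ExtModel p d := .inl a

/-- The embedding of the substructures. -/
def emb (δ a : K) (z : p.sub δ a) : ExtModel p d := .inr ⟨(δ, a), z⟩

theorem of_injective : Function.Injective (of : K → ExtModel p d) := Sum.inl_injective

theorem emb_injective (δ a : K) : Function.Injective (emb δ a : p.sub δ a → ExtModel p d) :=
  fun _ _ h => eq_of_heq (Sigma.mk.inj (Sum.inr_injective h)).2

/-- A projection to the substructures. -/
noncomputable def proj (δ a : K) : ExtModel p d → p.sub δ a := Function.invFun (emb δ a)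

@[simp] theorem proj_emb (δ a : K) (z : p.sub δ a) : proj δ a (emb δ a z : ExtModel p d) = z :=
  Function.leftInverse_invFun (emb_injective δ a) z

variable [LT K]

noncomputable instance : (extLanguage K ι L').Structure (ExtModel p d) where
  funMap := fun {n} f => match n, f with
    | _, .const a => fun _ => of a
    | _, .new => fun _ => of d
    | _, .fn i => fun x => Sum.elim (fun a => of (p.fn i a)) (fun _ => x 0) (x 0)
    -- For an index outside K the value is `x 1`, so the retraction is idempotent for every index.
    | _, .retr δ => fun x => Sum.elim (fun a => emb δ a (proj δ a (x 1))) (fun _ => x 1) (x 0)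
    | _, .sub δ _ f => fun x => Sum.elim (fun a => emb δ a
        (Language.Structure.funMap f fun i => proj δ a (x i.succ))) (fun _ => x 0) (x 0)
  RelMap := fun {n} R => match n, R with
    | _, .ord => fun x => ∃ a, x 0 = of a
    | _, .lt => fun x => ∃ a b, x 0 = of a ∧ x 1 = of b ∧ a < b
    | _, .sub δ _ R => fun x => ∃ a, x 0 = of a ∧
        Language.Structure.RelMap R fun i => proj δ a (x i.succ)

instance : Nonempty (ExtModel p d) := ⟨of d⟩

end ExtModel

namespace Ext
section
variable (L') (M : Type u) [(extLanguage K ι L').Structure M]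

variable (ι) in
/-- The value of the name of `a`. -/
def cst (a : K) : M :=
  Language.Structure.funMap (L := extLanguage K ι L') (ExtFunctions.const a) Fin.elim0

variable (ι) in
/-- The value of the additional constant. -/
def new : M :=
  Language.Structure.funMap (L := extLanguage K ι L')
    (ExtFunctions.new : ExtFunctions K ι L' 0) Fin.elim0

variable {M}

/-- The interpretation of the unary functions. -/
def fn (i : ι) (x : M) : M :=
  Language.Structure.funMap (L := extLanguage K ι L') (ExtFunctions.fn i) ![x]

variable (ι) in
/-- The interpretation of the retractions. -/
def retr (δ : K) (y x : M) : M :=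
  Language.Structure.funMap (L := extLanguage K ι L') (ExtFunctions.retr δ) ![y, x]

variable (ι) in
/-- The interpretation of the predicate for `K`. -/
def ord (x : M) : Prop :=
  Language.Structure.RelMap (L := extLanguage K ι L') (ExtRelations.ord : ExtRelations K L' 1) ![x]

variable (ι) in
/-- The interpretation of the order. -/
def lt (x y : M) : Prop :=
  Language.Structure.RelMap (L := extLanguage K ι L') (ExtRelations.lt : ExtRelations K L' 2) ![x, y]
end

section
variable {n m : ℕ}

def tCst (a : K) : (extLanguage K ι L').Term (Fin n) := .func (ExtFunctions.const a) Fin.elim0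
def tNew : (extLanguage K ι L').Term (Fin n) :=
  .func (ExtFunctions.new : ExtFunctions K ι L' 0) Fin.elim0
def tFn (i : ι) (t : (extLanguage K ι L').Term (Fin n)) : (extLanguage K ι L').Term (Fin n) :=
  .func (ExtFunctions.fn i) ![t]
def tRetr (δ : K) (s t : (extLanguage K ι L').Term (Fin n)) : (extLanguage K ι L').Term (Fin n) :=
  .func (ExtFunctions.retr δ) ![s, t]
def fOrd (t : (extLanguage K ι L').Term (Fin n)) : MSOFormula (extLanguage K ι L') n m :=
  .rel₁ (L := extLanguage K ι L') ExtRelations.ord t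
def fLt (s t : (extLanguage K ι L').Term (Fin n)) : MSOFormula (extLanguage K ι L') n m :=
  .rel₂ (L := extLanguage K ι L') ExtRelations.lt s t

variable {M : Type u} [(extLanguage K ι L').Structure M] {v : Fin n → M} {V : Fin m → Set M}
  {s t : (extLanguage K ι L').Term (Fin n)}

@[simp] theorem realize_tCst {a : K} :
    (tCst a : (extLanguage K ι L').Term (Fin n)).realize v = cst ι L' M a :=
  congrArg (Language.Structure.funMap (L := extLanguage K ι L') (ExtFunctions.const a))
    (Subsingleton.elim _ _)
@[simp] theorem realize_tNew :
    (tNew : (extLanguage K ι L').Term (Fin n)).realize v = new ι L' M :=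
  congrArg (Language.Structure.funMap (L := extLanguage K ι L') ExtFunctions.new)
    (Subsingleton.elim _ _)
@[simp] theorem realize_tFn {i : ι} : (tFn i t).realize v = fn L' i (t.realize v) :=
  congrArg _ (funext fun i => by fin_cases i; rfl)
@[simp] theorem realize_tRetr {δ : K} :
    (tRetr δ s t).realize v = retr ι L' δ (s.realize v) (t.realize v) :=
  congrArg _ (funext fun i => by fin_cases i <;> rfl)
@[simp] theorem realize_fOrd :
    (fOrd t : MSOFormula _ n m).Realize M v V ↔ ord ι L' (t.realize v) :=
  MSOFormula.realize_rel₁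
@[simp] theorem realize_fLt :
    (fLt s t : MSOFormula _ n m).Realize M v V ↔ lt ι L' (s.realize v) (t.realize v) :=
  MSOFormula.realize_rel₂
end

section
variable [LT K] {p : ExtData K ι L'} {d : K}
open ExtModel

@[simp] theorem cst_eq (a : K) : cst ι L' (ExtModel p d) a = of a := rfl
@[simp] theorem new_eq : new ι L' (ExtModel p d) = of d := rfl
@[simp] theorem fn_of (i : ι) (a : K) : fn L' i (of a : ExtModel p d) = of (p.fn i a) := rfl
@[simp] theorem retr_of (δ a : K) (x : ExtModel p d) :
    retr ι L' δ (of a) x = emb δ a (proj δ a x) := rfl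
theorem retr_retr (δ : K) (y x : ExtModel p d) :
    retr ι L' δ y (retr ι L' δ y x) = retr ι L' δ y x := by
  rcases y with a | _
  · change retr ι L' δ (of a) (retr ι L' δ (of a) x) = retr ι L' δ (of a) x
    simp
  · rfl
theorem lt_iff {x y : ExtModel p d} : lt ι L' x y ↔ ∃ a b, x = of a ∧ y = of b ∧ a < b := Iff.rfl
@[simp] theorem lt_of_of {a b : K} : lt ι L' (of a : ExtModel p d) (of b) ↔ a < b := by
  simp only [lt_iff, of_injective.eq_iff]
  exact ⟨fun ⟨_, _, h1, h2, h⟩ => h1 ▸ h2 ▸ h, fun h => ⟨a, b, rfl, rfl, h⟩⟩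
end
end Ext

end

theorem snoc_elim0_eq_cons {N M : Type u} (y : M) (f : N → M) :
    Fin.snoc (α := fun _ : Fin 1 => M) Fin.elim0 y = Fin.cons y (f ∘ Fin.elim0) := by
  funext i
  fin_cases i
  rfl

/-! ### The least unnamed point and its ultrafilter -/

section
variable {K ι : Type u} {L' : K → FirstOrder.Language.{u, u}}

open MSOFormula Ext ExtModel Language.Structure

/-- The relativisation of formulas to the substructures. -/
def Ext.relativize (ι : Type u) (δ : K) {n m : ℕ} (φ : MSOFormula (L' δ) n m) :
    MSOFormula (extLanguage K ι L') (n + 1) m :=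
  φ.relativize (L := extLanguage K ι L') (ExtFunctions.retr δ) (fun k f => .sub δ k f)
    (fun k R => .sub δ k R)

theorem Ext.realize_relativize_of [LT K] {p : ExtData K ι L'} {d : K} (δ a : K) (φ : MSOSentence (L' δ)) :
    (Ext.relativize ι δ φ).Realize (ExtModel p d)
        (Fin.snoc (α := fun _ => ExtModel p d) Fin.elim0 (of a)) Fin.elim0 ↔
      MSOSentence.Holds (p.sub δ a) φ := by
  have := MSOFormula.realize_relativize (L := extLanguage K ι L') (M := ExtModel p d)
    (r := ExtFunctions.retr δ) (ff := fun k f => .sub δ k f) (rr := fun k R => .sub δ k R)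
    (y := of a) (emb := emb δ a) (emb_injective δ a)
    (fun x => ⟨fun h => ⟨proj δ a x, h⟩, by rintro ⟨z, rfl⟩; exact congrArg (emb δ a) (proj_emb δ a z)⟩)
    (fun k f z => by
      change emb δ a (proj δ a (emb δ a (funMap f fun i => proj δ a (emb δ a (z i))))) = _
      simp)
    (fun k R z => by
      change (∃ b, of a = of b ∧ RelMap R fun i => proj δ b (emb δ a (z i))) ↔ _
      constructor
      · rintro ⟨b, h, hb⟩
        obtain rfl := of_injective h
        simpa using hb
      · exact fun h => ⟨a, rfl, by simpa using h⟩) φ Fin.elim0 Fin.elim0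
  rw [MSOSentence.Holds, snoc_elim0_eq_cons (of a) (emb δ a : p.sub δ a → ExtModel p d)]
  rwa [Subsingleton.elim (fun i : Fin 0 => (emb δ a : p.sub δ a → ExtModel p d) ⁻¹' Fin.elim0 i) Fin.elim0] at this

/-- An element `y` of a model in which the retractions are idempotent gives rise to a structure. -/
theorem Ext.exists_substructure {M : Type u} [(extLanguage K ι L').Structure M] (δ : K) (y : M)
    (hM : ∀ x, retr ι L' δ y (retr ι L' δ y x) = retr ι L' δ y x) :
    ∃ (N : Type u) (_ : Nonempty N) (_ : (L' δ).Structure N), ∀ φ : MSOSentence (L' δ),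
      (Ext.relativize ι δ φ).Realize M (Fin.snoc (α := fun _ => M) Fin.elim0 y) Fin.elim0 ↔
      MSOSentence.Holds N φ := by
  let N := {x : M // retr ι L' δ y x = x}
  let iN : (L' δ).Structure N :=
    { funMap := fun {k} f z => ⟨retr ι L' δ y (funMap (L := extLanguage K ι L')
        (ExtFunctions.sub δ k f) (Fin.cons y (Subtype.val ∘ z) : Fin (k + 1) → M)), hM _⟩
      RelMap := fun {k} R z => RelMap (L := extLanguage K ι L')
        (ExtRelations.sub δ k R) (Fin.cons y (Subtype.val ∘ z) : Fin (k + 1) → M) }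
  refine ⟨N, ⟨⟨retr ι L' δ y y, hM y⟩⟩, iN, fun φ => ?_⟩
  have := MSOFormula.realize_relativize (L := extLanguage K ι L') (M := M) (N := N)
    (r := ExtFunctions.retr δ) (ff := fun k f => .sub δ k f) (rr := fun k R => .sub δ k R)
    (y := y) (emb := Subtype.val) Subtype.val_injective
    (fun x => ⟨fun h => ⟨⟨x, h⟩, rfl⟩, by rintro ⟨z, rfl⟩; exact z.2⟩)
    (fun k f z => rfl) (fun k R z => Iff.rfl) φ Fin.elim0 Fin.elim0
  rw [MSOSentence.Holds, snoc_elim0_eq_cons y (Subtype.val : N → M)]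
  rwa [Subsingleton.elim (fun i : Fin 0 => (Subtype.val : N → M) ⁻¹' Fin.elim0 i) Fin.elim0] at this

/-- The core of the argument: `κ` many regressive functions on a well-order of size `κ` are
simultaneously constant almost everywhere or the identity almost everywhere for a suitable
ultrafilter. -/
theorem exists_ultrafilter_of_mem_weakCompactnessSpectrum [LinearOrder K] [WellFoundedLT K]
    {κ : Cardinal.{u}}
    (hκ : κ ∈ weakCompactnessSpectrum) (hK : #K = κ) (hι : #ι ≤ κ) (fn : ι → K → K)
    (hfn : ∀ i a, fn i a ≤ a) (hL : ∀ δ, (L' δ).card ≤ κ) (φ : ∀ δ, K → MSOSentence (L' δ))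
    (hφ : ∀ δ, ∀ a < δ, MSOSatisfiable (φ δ '' Set.Iio a))
    (hφ' : ∀ δ, ¬ IsBot δ → ¬ MSOSatisfiable (φ δ '' Set.Iio δ)) :
    ∃ U : Ultrafilter K, (∀ a, ∀ᶠ x in (U : Filter K), a < x) ∧
      ∀ i, (∃ a, ∀ᶠ x in (U : Filter K), fn i x = a) ∨ ∀ᶠ x in (U : Filter K), fn i x = x := by
  have hN : ∀ δ a : K, ∃ (N : Type u) (_ : Nonempty N) (_ : (L' δ).Structure N),
      a < δ → ∀ ψ ∈ φ δ '' Set.Iio a, MSOSentence.Holds N ψ := by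
    intro δ a
    by_cases h : a < δ
    · obtain ⟨N, h1, h2, h3⟩ := hφ δ a h
      exact ⟨N, h1, h2, fun _ => h3⟩
    · exact ⟨PUnit, ⟨⟨⟩⟩, ⟨fun _ _ => ⟨⟩, fun _ _ => True⟩, fun h' => (h h').elim⟩
  choose N hN1 hN2 hN3 using hN
  let p : ExtData K ι L' := ⟨N, hN1, hN2, fn⟩
  obtain ⟨M, -, iM, hM, hne⟩ := exists_structure_of_mem_weakCompactnessSpectrum hκ
    (L := extLanguage K ι L') (card_extLanguage_le hκ.1.le hK.le hι hL) (S := K) hK.ge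
    (fun s => ExtModel p s) (fun s => .not (.equal tNew (tCst s)))
    (fun s t => by
      simp only [holds_def, realize_not, realize_equal, realize_tNew, realize_tCst, new_eq, cst_eq]
      exact not_congr (of_injective (p := p) (d := s)).eq_iff)
  let c : K → M := cst ι L' M
  let R : M → M → Prop := lt ι L'
  let O : M → Prop := ord ι L'
  have m_trans : ∀ x y z : M, R x y → R y z → R x z := by
    have := hM (.all (.all (.all (.imp (fLt (.var 0) (.var 1)) (.imp (fLt (.var 1) (.var 2))
      (fLt (.var 0) (.var 2))))))) fun s => by
      simp [holds_def]
      rintro _ _ _ ⟨a, b, rfl, rfl, h1⟩ ⟨b', e, h2, rfl, h3⟩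
      obtain rfl := of_injective h2
      exact lt_of_of.2 (h1.trans h3)
    simpa [holds_def] using this
  have m_tri : ∀ x y : M, O x → O y → R x y ∨ x = y ∨ R y x := by
    have := hM (.all (.all (.imp (fOrd (.var 0)) (.imp (fOrd (.var 1)) (.or (fLt (.var 0) (.var 1))
      (.or (.equal (.var 0) (.var 1)) (fLt (.var 1) (.var 0)))))))) fun s => by
      simp [holds_def]
      rintro _ _ ⟨a, rfl⟩ ⟨b, rfl⟩
      simpa [of_injective.eq_iff] using lt_trichotomy a b
    simpa [holds_def] using this
  have m_ord (a : K) : O (c a) := by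
    simpa [holds_def] using hM (fOrd (tCst a)) fun s => by
      simp [holds_def]
      exact ⟨a, rfl⟩
  have m_new : O (new ι L' M) := by
    simpa [holds_def] using hM (fOrd tNew) fun s => by
      simp [holds_def]
      exact ⟨s, rfl⟩
  have m_lt_ord : ∀ x y : M, R x y → O x := by
    have := hM (.all (.all (.imp (fLt (.var 0) (.var 1)) (fOrd (.var 0))))) fun s => by
      simp [holds_def]
      rintro _ _ ⟨a, b, rfl, rfl, h1⟩
      exact ⟨a, rfl⟩
    simpa [holds_def] using this
  have m_wf : ∀ X : Set M, (∀ x, (∀ y, R y x → y ∈ X) → x ∈ X) → ∀ x, x ∈ X := by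
    have := hM (.allSet (.imp (.all (.imp (.all (.imp (fLt (.var 1) (.var 0)) (.mem 1 0)))
      (.mem 0 0))) (.all (.mem 0 0)))) fun s => by
      simp [holds_def]
      intro X hX x
      have H (a : K) : of a ∈ X := by
        induction a using WellFoundedLT.induction with
        | ind a ih =>
          refine hX _ ?_
          rintro _ ⟨b, a', rfl, h, hlt⟩
          obtain rfl := of_injective h
          exact ih b hlt
      refine hX x ?_
      rintro _ ⟨a, b, rfl, -⟩
      exact H a
    simpa [holds_def] using this
  have m_lt (a b : K) (h : a < b) : R (c a) (c b) := by
    simpa [holds_def] using hM (fLt (tCst a) (tCst b)) fun s => by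
      simp [holds_def, h]
  have m_bot (a : K) (h : IsBot a) : ∀ x : M, ¬ R x (c a) := by
    have := hM (.all (.not (fLt (.var 0) (tCst a)))) fun s => by
      simp [holds_def]
      rintro _ ⟨b, a', rfl, h1, h2⟩
      obtain rfl := of_injective h1
      exact (h b).not_gt h2
    simpa [holds_def] using this
  have m_fn (i : ι) : ∀ x : M, O x → R (Ext.fn L' i x) x ∨ Ext.fn L' i x = x := by
    have := hM (.all (.imp (fOrd (.var 0)) (.or (fLt (tFn i (.var 0)) (.var 0))
      (.equal (tFn i (.var 0)) (.var 0))))) fun s => by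
      simp [holds_def]
      rintro _ ⟨a, rfl⟩
      simpa [of_injective.eq_iff] using (hfn i a).lt_or_eq
    simpa [holds_def] using this
  have m_retr (δ : K) : ∀ y x : M, retr ι L' δ y (retr ι L' δ y x) = retr ι L' δ y x := by
    have := hM (.all (.all (.equal (tRetr δ (.var 0) (tRetr δ (.var 0) (.var 1)))
      (tRetr δ (.var 0) (.var 1))))) fun s => by
      simp [holds_def, retr_retr]
    simpa [holds_def] using this
  -- In the original structures, an index a strictly between b and δ carries a model of the first a
  -- sentences of the δ-th theory, among them the b-th.
  have m_sub (δ b : K) (hb : b < δ) : ∀ y : M, R (c b) y → R y (c δ) →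
      (Ext.relativize ι δ (φ δ b)).Realize M (Fin.snoc (α := fun _ => M) Fin.elim0 y) Fin.elim0 := by
    have := hM (.all (.imp (fLt (tCst b) (.var 0)) (.imp (fLt (.var 0) (tCst δ))
      (Ext.relativize ι δ (φ δ b))))) fun s => by
      simp only [holds_def, realize_all, realize_imp, realize_fLt, realize_tCst,
        Language.Term.realize_var, snoc_zero_zero]
      rintro _ ⟨b', a, h1, rfl, h2⟩ ⟨a', δ', h3, h4, h5⟩
      obtain rfl := of_injective h1
      obtain rfl := of_injective h3
      obtain rfl := of_injective h4
      rw [Ext.realize_relativize_of]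
      exact hN3 δ a h5 _ ⟨b, h2, rfl⟩
    simpa only [holds_def, realize_all, realize_imp, realize_fLt, realize_tCst,
        Language.Term.realize_var, snoc_zero_zero] using this
  -- the named elements form an initial segment
  have named (δ : K) : ∀ x : M, R x (c δ) → ∃ b, x = c b := by
    induction δ using WellFoundedLT.induction with
    | ind δ ih =>
      intro x hx
      by_contra hcon
      have hlt : ∀ b < δ, R (c b) x := by
        intro b hb
        obtain h | h | h := m_tri x (c b) (m_lt_ord _ _ hx) (m_ord b)
        · exact (hcon (ih b hb x h)).elim
        · exact (hcon ⟨b, h⟩).elim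
        · exact h
      by_cases hbot : IsBot δ
      · exact m_bot δ hbot x hx
      · obtain ⟨N, hN, iN, hNφ⟩ := Ext.exists_substructure (ι := ι) δ x (m_retr δ x)
        refine hφ' δ hbot ⟨N, hN, iN, ?_⟩
        rintro _ ⟨b, hb, rfl⟩
        exact (hNφ _).1 (m_sub δ b hb x (hlt b hb) hx)
  -- The least unnamed point, which exists because the order is well-founded and `new` is unnamed.
  obtain ⟨x, hxO, hxc, hx⟩ : ∃ x : M, O x ∧ (∀ a, x ≠ c a) ∧ ∀ y, R y x → ∃ a, y = c a := by
    by_contra! H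
    have := m_wf {x | O x → ∃ a, x = c a} (fun x hx hxO => by
      by_contra! hne
      obtain ⟨y, hy, hy'⟩ := H x hxO hne
      obtain ⟨a, ha⟩ := hx y hy (m_lt_ord _ _ hy)
      exact hy' a ha) (new ι L' M) m_new
    obtain ⟨a, ha⟩ := this
    have := hne a
    simp only [holds_def, realize_not, realize_equal, realize_tNew, realize_tCst] at this
    exact this ha
  have hcx (a : K) : R (c a) x := by
    obtain h | h | h := m_tri (c a) x (m_ord a) hxO
    · exact h
    · exact (hxc a h.symm).elim
    · obtain ⟨b, hb⟩ := named a x h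
      exact (hxc b hb).elim
  -- the ultrafilter of sets to which `x` belongs
  let Def : Set K → Prop := fun X => ∃ θ : MSOFormula (extLanguage K ι L') 1 0,
    (∀ s a, θ.Realize (ExtModel p s) (Fin.snoc (α := fun _ => ExtModel p s) Fin.elim0 (of a))
      Fin.elim0 ↔ a ∈ X) ∧
    θ.Realize M (Fin.snoc (α := fun _ => M) Fin.elim0 x) Fin.elim0
  let F : Filter K :=
    { sets := {X | ∃ Y ⊆ X, Def Y}
      univ_sets := ⟨Set.univ, le_rfl, MSOFormula.falsum.not, fun s a => by simp, by simp⟩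
      sets_of_superset := fun ⟨Y, hY, h⟩ hXZ => ⟨Y, hY.trans hXZ, h⟩
      inter_sets := fun ⟨Y, hY, θ, h1, h2⟩ ⟨Z, hZ, θ', h3, h4⟩ =>
        ⟨Y ∩ Z, Set.inter_subset_inter hY hZ, θ.and θ', fun s a => by
          rw [realize_and, h1, h3]; rfl, by rw [realize_and]; exact ⟨h2, h4⟩⟩ }
  have hF (X : Set K) (h : Def X) : X ∈ F := ⟨X, le_rfl, h⟩
  -- If θ defines the empty set in all the original structures, the sentence saying that no point of
  -- the order satisfies θ transfers to M, where x refutes it.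
  have : F.NeBot := by
    rw [Filter.neBot_iff, ne_eq, ← Filter.empty_mem_iff_bot]
    rintro ⟨Y, hY, θ, h1, h2⟩
    obtain rfl := Set.subset_empty_iff.1 hY
    have := hM (.all (.imp (fOrd (.var 0)) θ.not)) fun s => by
      simp only [holds_def, realize_all, realize_imp, realize_fOrd, realize_not,
        Language.Term.realize_var, snoc_zero_zero]
      rintro _ ⟨a, rfl⟩
      rw [h1]
      exact Set.notMem_empty a
    simp only [holds_def, realize_all, realize_imp, realize_fOrd, realize_not,
        Language.Term.realize_var, snoc_zero_zero] at this
    exact this x hxO h2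
  have hU (X : Set K) (h : Def X) : X ∈ Ultrafilter.of F := Ultrafilter.of_le F (hF X h)
  refine ⟨Ultrafilter.of F, fun a => hU _ ⟨fLt (tCst a) (.var 0), fun s b => ?_, ?_⟩, fun i => ?_⟩
  · simp
  · simpa using hcx a
  · obtain h | h := m_fn i x hxO
    · obtain ⟨a, ha⟩ := hx _ h
      exact Or.inl ⟨a, hU _ ⟨.equal (tFn i (.var 0)) (tCst a), fun s b => by
        simp [of_injective.eq_iff, p], by simpa using ha⟩⟩
    · exact Or.inr (hU _ ⟨.equal (tFn i (.var 0)) (.var 0), fun s b => by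
        simp [of_injective.eq_iff, p], by simpa using h⟩)
end

/-! ### The least element of the spectrum -/

theorem hasNormalUltrafilters_of_isLeast {κ : Cardinal.{u}}
    (hκ : IsLeast weakCompactnessSpectrum κ) : HasNormalUltrafilters κ := by
  intro F hF
  have hω : ℵ₀ < κ := hκ.1.1
  have hT (δ : κ.ord.ToType) : ∃ (L : FirstOrder.Language.{u, u}) (_ : L.card ≤ κ)
      (φ : Ordinal.{u} → MSOSentence L), (∀ α < δ.toOrd.1, MSOSatisfiable (φ '' Set.Iio α)) ∧
        (δ.toOrd.1 ≠ 0 → ¬ MSOSatisfiable (φ '' Set.Iio δ.toOrd.1)) := by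
    by_cases h0 : δ.toOrd.1 = 0
    · exact ⟨chainLanguage, card_chainLanguage_le.trans hω.le, fun _ => .falsum,
        fun α hα => (not_lt_zero (h0 ▸ hα)).elim, fun h => (h h0).elim⟩
    · obtain ⟨L, hL, φ, h1, h2⟩ := hasLimitTheory_of_lt hω.le
        (fun η hη hmem => (hκ.2 hmem).not_gt hη) δ.toOrd.2 h0
      exact ⟨L, hL, φ, h1, fun _ => h2⟩
  choose L hL φ hφ hφ' using hT
  have himage (δ a : κ.ord.ToType) :
      (fun b : κ.ord.ToType => φ δ b.toOrd.1) '' Set.Iio a = φ δ '' Set.Iio a.toOrd.1 := by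
    ext ψ
    constructor
    · rintro ⟨b, hb, rfl⟩
      exact ⟨b.toOrd.1, Ordinal.ToType.mk.symm.lt_iff_lt.2 hb, rfl⟩
    · rintro ⟨b, hb, rfl⟩
      have hb' : b < κ.ord := lt_trans hb a.toOrd.2
      refine ⟨Ordinal.ToType.mk ⟨b, hb'⟩, ?_, by simp⟩
      rw [Set.mem_Iio, ← Ordinal.ToType.mk.symm.lt_iff_lt, OrderIso.symm_apply_apply]
      exact hb
  obtain ⟨e⟩ : Nonempty (F ↪ κ.ord.ToType) := by
    rw [← Cardinal.lift_mk_le']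
    rw [mk_ord_toType]
    exact (Cardinal.lift_id'.{u, u + 1} #F).trans_le hF
  classical
  -- Each function of F is replaced by the identity wherever it is not regressive. If it is
  -- regressive almost everywhere, its modification cannot be the identity almost everywhere, so it
  -- is almost constant.
  let G : κ.ord.ToType → κ.ord.ToType → κ.ord.ToType := fun k a =>
    if h : ∃ f : F, e f = k ∧ f.1 a.toOrd.1 < a.toOrd.1 then
      Ordinal.ToType.mk ⟨h.choose.1 a.toOrd.1, h.choose_spec.2.trans a.toOrd.2⟩ else a
  have G_of_lt (f : F) (a : κ.ord.ToType) (h : f.1 a.toOrd.1 < a.toOrd.1) :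
      (G (e f) a).toOrd.1 = f.1 a.toOrd.1 := by
    have H : ∃ g : F, e g = e f ∧ g.1 a.toOrd.1 < a.toOrd.1 := ⟨f, rfl, h⟩
    have : H.choose = f := e.injective H.choose_spec.1
    simp only [G, dif_pos H, Ordinal.ToType.toOrd, OrderIso.symm_apply_apply, this]
  have G_le (k a : κ.ord.ToType) : G k a ≤ a := by
    by_cases H : ∃ f : F, e f = k ∧ f.1 a.toOrd.1 < a.toOrd.1
    · obtain ⟨f, rfl, h⟩ := H
      rw [← Ordinal.ToType.mk.symm.le_iff_le]
      exact (G_of_lt f a h).trans_le h.le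
    · simp only [G, dif_neg H, le_refl]
  obtain ⟨U, hU1, hU2⟩ := exists_ultrafilter_of_mem_weakCompactnessSpectrum hκ.1
    (K := κ.ord.ToType) (by simp) (ι := κ.ord.ToType) (by simp) G G_le (L' := L) hL
    (fun δ b => φ δ b.toOrd.1)
    (fun δ a ha => himage δ a ▸ hφ δ _ (Ordinal.ToType.mk.symm.lt_iff_lt.2 ha))
    (fun δ hδ => himage δ δ ▸ hφ' δ fun h0 => hδ fun b => by
      rw [← Ordinal.ToType.mk.symm.le_iff_le]
      exact h0.trans_le (zero_le))
  refine ⟨U.map fun a => a.toOrd.1, ?_, fun α hα => ?_, fun f hf hreg => ?_⟩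
  · have : ∀ᶠ a in (U : Filter κ.ord.ToType), a.toOrd.1 < κ.ord :=
      Filter.Eventually.of_forall fun a => a.toOrd.2
    exact this
  · have : ∀ᶠ a in (U : Filter κ.ord.ToType), α < a.toOrd.1 := by
      filter_upwards [hU1 (Ordinal.ToType.mk ⟨α, hα⟩)] with a ha
      rw [← Ordinal.ToType.mk.symm.lt_iff_lt, OrderIso.symm_apply_apply] at ha
      exact ha
    exact this
  · have hreg : ∀ᶠ a in (U : Filter κ.ord.ToType), f a.toOrd.1 < a.toOrd.1 := hreg
    obtain ⟨b, hb⟩ | h := hU2 (e ⟨f, hf⟩)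
    · refine ⟨b.toOrd.1, b.toOrd.2, ?_⟩
      have : ∀ᶠ a in (U : Filter κ.ord.ToType), f a.toOrd.1 = b.toOrd.1 := by
        filter_upwards [hreg, hb] with a h1 h2
        exact (G_of_lt ⟨f, hf⟩ a h1).symm.trans (by rw [h2])
      exact this
    · obtain ⟨a, h1, h2⟩ := (hreg.and h).exists
      have := G_of_lt ⟨f, hf⟩ a h1
      rw [h2] at this
      exact (h1.ne this.symm).elim

theorem exists_isLeast_weakCompactnessSpectrum (h : weakCompactnessNumber.{u} < ⊤) :
    ∃ κ : Cardinal.{u}, IsLeast weakCompactnessSpectrum κ ∧ weakCompactnessNumber = κ := by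
  have hne : weakCompactnessSpectrum.{u}.Nonempty := by
    by_contra hne
    rw [Set.not_nonempty_iff_eq_empty] at hne
    simp [weakCompactnessNumber, hne] at h
  have hleast : IsLeast weakCompactnessSpectrum (sInf weakCompactnessSpectrum.{u}) :=
    ⟨csInf_mem hne, fun _ => csInf_le'⟩
  exact ⟨_, hleast, (WithTop.coe_strictMono.monotone.map_isLeast hleast).csInf_eq⟩

/-- Part (1) says that the first weakly Mahlo cardinal (`i = k = 0`), the first weakly
hyper-Mahlo cardinal and so on exist and lie below the weak compactness number. A weakly
hyper-Mahlo cardinal may be read either as a weakly Mahlo cardinal in which the weakly Mahlo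
cardinals are stationary (`i = 0`, `k = 1`, with iterates `i = 0`, `k = 2, 3, …`), or as a
`κ` which is weakly `κ`-Mahlo (`i = 1`, `k = 0`, with iterates `i = 2, 3, …`, `k = 0`). -/
theorem proposition2p7 :
    (weakCompactnessNumber.{u} < ⊤ →
      ∀ i k : ℕ, ∃ ν : Cardinal.{u},
        IsLeast {μ : Cardinal.{u} | StationaryLimit (IsWeaklyHyperMahlo i) k μ} ν ∧
          (ν : WithTop Cardinal.{u}) < weakCompactnessNumber.{u}) ∧
    ∀ n : ℕ, (Order.succ^[n] (2 ^ ℵ₀ : Cardinal.{u})) ∉ weakCompactnessSpectrum.{u} := by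
  refine ⟨fun h i k => ?_, succ_iterate_continuum_notMem_weakCompactnessSpectrum⟩
  obtain ⟨κ, hκ, hw⟩ := exists_isLeast_weakCompactnessSpectrum h
  obtain ⟨μ, hμκ, hμ⟩ :=
    (hasNormalUltrafilters_of_isLeast hκ).exists_stationaryLimit_lt hκ.1.1 i k
  have hne : {μ : Cardinal.{u} | StationaryLimit (IsWeaklyHyperMahlo i) k μ}.Nonempty := ⟨μ, hμ⟩
  refine ⟨sInf {μ : Cardinal.{u} | StationaryLimit (IsWeaklyHyperMahlo i) k μ},
    ⟨csInf_mem hne, fun _ => csInf_le'⟩, ?_⟩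
  rw [hw, WithTop.coe_lt_coe]
  exact (csInf_le' (show μ ∈ {μ | _} from hμ)).trans_lt hμκ
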